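/- Let $\mathbf H$ be a real or complex Hilbert space with norm $\|\cdot\|$ and let $A$ be a (possibly unbounded) self-adjoint positive definite operator on a dense domain $D(A)\subset\mathbf H$ with compact inverse. Put $\|w\|_q=\|A^{q/2}w\|=(A^qw,w)^{1/2}$, so that $\|w\|_2=\|Aw\|$, and $E(t)=\exp(-tA)$. For $1\le j\le m$ (where $m\ge 1$) let $B_j$ be a self-adjoint operator with $D(B_j)\supset D(A)$ and, with some constant $C_j$, $|(B_jw,z)|\le C_j\|w\|_q\|z\|_\vartheta$ for all $w,z\in D(A)$, $\vartheta=0,1,2$, $q+\vartheta=2$. Let $\kappa\ge 0$, $\alpha_j\in(0,1)$, $\alpha=\min_j\alpha_j$, $0<T<\infty$ and $\beta_j(t)=e^{-\kappa t}t^{\alpha_j-1}/\Gamma(\alpha_j)$. Then there is a constant $K>0$, depending only on $A$, $B_1,\dots,B_m$, $\alpha_1,\dots,\alpha_m$, $\kappa$ and $T$, with the following property. Let $u_0\in D(A)$, let $f$ be a function from $[0,T]$ to $\mathbf H$, and let $u$ be a strong solution on $[0,T]$ of $$u'(t)+Au(t)+\sum_{j=1}^m\int_0^t\beta_j(t-s)B_ju(s)\,ds=f(t)\quad(0<t\le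 T),\qquad u(0)=u_0,$$ that is, $u$ is continuous on $[0,T]$ and at each $t\in(0,T]$ it is differentiable, $u(t)\in D(A)$, the integrals converge (as Bochner integrals) and the equation holds. Put $g(t)=e^{\kappa t}f(t)$ and $v(t)=e^{\kappa t}u(t)$; thus $v$ solves $$v'(t)+Av(t)+\sum_{j=1}^m\int_0^t\frac{(t-s)^{\alpha_j-1}}{\Gamma(\alpha_j)}B_jv(s)\,ds-\kappa v(t)=g(t),\qquad v(0)=u_0 .$$ Suppose that $g$ is continuous on $[0,T]$ and twice differentiable on $(0,T]$ and that, for some constant $M$ and all $t\in(0,T]$, $$\|Au_0-g(0)\|+\|g(t)\|\le M,\qquad \|E'(t)(Au_0-g(0))\|+\|g'(t)\|+t\|g''(t)\|\le M\,t^{\alpha-1}.$$ Then $v$ is twice differentiable on $(0,T]$, $v'(t)\in D(A)$, and $$\|v''(t)\|+\|Av'(t)\|\le K\,t^{\alpha-1}\bigl(\|u_0\|_2+M\bigr),\qquad t\in(0,T].$$ In particular, if $u_0\neq 0$, there is a constant $C$ (independent of $t$; one may take $C=K(1+M/\|u_0\|_2)$) such that $$\|v''(t)\|+\|Av'(t)\|\le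 C\,t^{\alpha-1}\|u_0\|_2,\qquad t\in(0,T].$$ Derivatives at $t=T$ are taken from the left. -/

import Mathlib

open Set

/-- The value `A x` of a partially defined operator, with the junk value `0` off the domain (it is
only used at points whose membership in the domain is required separately). -/
noncomputable def opApply {𝕜 H : Type*} [RCLike 𝕜] [NormedAddCommGroup H] [InnerProductSpace 𝕜 H]
    (A : H →ₗ.[𝕜] H) (x : H) : H :=
  open scoped Classical in if h : x ∈ A.domain then A ⟨x, h⟩ else 0

/-- `A` is a (possibly unbounded) densely defined self-adjoint positive definite operator with a
compact inverse. -/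
structure IsPosDefWithCompactInverse {𝕜 H : Type*} [RCLike 𝕜] [NormedAddCommGroup H]
    [InnerProductSpace 𝕜 H] [CompleteSpace H] (A : H →ₗ.[𝕜] H) : Prop where
  dense_domain : Dense (A.domain : Set H)
  selfAdjoint : IsSelfAdjoint A
  pos : ∀ x : A.domain, (x : H) ≠ 0 → 0 < RCLike.re (inner 𝕜 (A x) (x : H))
  compact_inverse : ∃ R : H →L[𝕜] H, IsCompactOperator R ∧
    (∀ y : H, ∃ h : R y ∈ A.domain, A ⟨R y, h⟩ = y) ∧ ∀ x : A.domain, R (A x) = (x : H)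

/-- The norms `‖x‖_q = ‖A^{q/2} x‖ = (A^q x, x)^{1/2}`, `q = 0, 1, 2`, for `x` in the domain of the
positive self-adjoint operator `A`. -/
noncomputable def scaleNorm {𝕜 H : Type*} [RCLike 𝕜] [NormedAddCommGroup H]
    [InnerProductSpace 𝕜 H] (A : H →ₗ.[𝕜] H) : Fin 3 → A.domain → ℝ
  | 0, x => ‖(x : H)‖
  | 1, x => Real.sqrt (RCLike.re (inner 𝕜 (A x) (x : H)))
  | 2, x => ‖A x‖

/-- `B` is self-adjoint, `D(B) ⊇ D(A)`, and `A` dominates `B`: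
`|(B w, z)| ≤ C ‖w‖_q ‖z‖_θ` for `θ = 0, 1, 2` and `q + θ = 2`. -/
structure IsDominatedBy {𝕜 H : Type*} [RCLike 𝕜] [NormedAddCommGroup H]
    [InnerProductSpace 𝕜 H] [CompleteSpace H] (B A : H →ₗ.[𝕜] H) : Prop where
  selfAdjoint : IsSelfAdjoint B
  domain_le : A.domain ≤ B.domain
  bound : ∃ C : ℝ, ∀ q θ : Fin 3, (q : ℕ) + (θ : ℕ) = 2 → ∀ w z : A.domain,
    ‖inner 𝕜 (B ⟨w, domain_le w.2⟩) (z : H)‖ ≤ C * scaleNorm A q w * scaleNorm A θ z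

/-- The eigenspace `{x ∈ D(A) : A x = l x}` of a partially defined operator. -/
def opEigenspace {𝕜 H : Type*} [RCLike 𝕜] [NormedAddCommGroup H] [InnerProductSpace 𝕜 H]
    (A : H →ₗ.[𝕜] H) (l : ℝ) : Submodule 𝕜 H where
  carrier := {x | ∃ h : x ∈ A.domain, A ⟨x, h⟩ = (l : 𝕜) • x}
  zero_mem' := ⟨A.domain.zero_mem, by
    rw [smul_zero]; exact A.map_zero⟩
  add_mem' := by
    rintro x y ⟨hx, hx'⟩ ⟨hy, hy'⟩
    refine ⟨A.domain.add_mem hx hy, ?_⟩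
    rw [smul_add, ← hx', ← hy', ← A.map_add]; rfl
  smul_mem' := by
    rintro c x ⟨hx, hx'⟩
    refine ⟨A.domain.smul_mem c hx, ?_⟩
    rw [smul_comm, ← hx', ← A.map_smul]; rfl

/-- The semigroup `E(t) = exp(-tA)`, `t > 0`, of a positive self-adjoint operator `A` with compact
inverse, through the spectral decomposition `exp(-tA) w = ∑_l e^{-lt} P_l w`, where `P_l` is the
orthogonal projection onto the eigenspace of `l` (the eigenspaces of such an operator are closed, so
that the closure is only there to let Lean form the projection). -/
noncomputable def expSemigroup {𝕜 H : Type*} [RCLike 𝕜] [NormedAddCommGroup H]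
    [InnerProductSpace 𝕜 H] [CompleteSpace H] (A : H →ₗ.[𝕜] H) (t : ℝ) (w : H) : H :=
  ∑' l : ℝ, ((Real.exp (-(l * t)) : ℝ) : 𝕜) •
    (opEigenspace A l).topologicalClosure.starProjection w

/-- The tempered Abel kernel `e^{-κt} t^{a-1} / Γ(a)`. -/
noncomputable def temperedKernel (κ a t : ℝ) : ℝ :=
  Real.exp (-(κ * t)) * t ^ (a - 1) / Real.Gamma a

/-- `u` is a strong solution on `[0,T]` of
`u' + A u + ∑_j β_j * B_j u = f`, `u(0) = u₀`, with `β_j(t) = e^{-κt} t^{α_j-1} / Γ(α_j)`: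
it is continuous on `[0,T]`, and at every `t ∈ (0,T]` it is differentiable (from the left at `T`),
takes its value in `D(A)`, the convolution integrals converge and the equation holds. -/
structure IsTemperedSolution {𝕜 H : Type*} [RCLike 𝕜] [NormedAddCommGroup H]
    [InnerProductSpace 𝕜 H] [NormedSpace ℝ H] {m : ℕ}
    (A : H →ₗ.[𝕜] H) (B : Fin m → H →ₗ.[𝕜] H) (α : Fin m → ℝ) (κ T : ℝ)
    (f : ℝ → H) (u₀ : H) (u : ℝ → H) : Prop where
  continuousOn : ContinuousOn u (Icc 0 T)
  initial : u 0 = u₀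
  mem_domain : ∀ t ∈ Ioc 0 T, u t ∈ A.domain
  integrable : ∀ j, ∀ t ∈ Ioc 0 T, IntervalIntegrable
    (fun s => temperedKernel κ (α j) (t - s) • opApply (B j) (u s)) MeasureTheory.volume 0 t
  equation : ∀ t ∈ Ioc 0 T, ∃ u' : H, HasDerivWithinAt u u' (Ioc 0 T) t ∧
    u' + opApply A (u t)
      + ∑ j, (∫ s in (0 : ℝ)..t, temperedKernel κ (α j) (t - s) • opApply (B j) (u s)) = f t

/-- The assumptions on the data: with `g', g''` the first two derivatives of `g` on `(0,T]`,
`‖A u₀ - g(0)‖ + ‖g(t)‖ ≤ M` and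
`‖E'(t)(A u₀ - g(0))‖ + ‖g'(t)‖ + t ‖g''(t)‖ ≤ M t^{a-1}` on `(0,T]`, where `E(t) = exp(-tA)`. -/
structure DataBound {𝕜 H : Type*} [RCLike 𝕜] [NormedAddCommGroup H]
    [InnerProductSpace 𝕜 H] [NormedSpace ℝ H] [CompleteSpace H]
    (A : H →ₗ.[𝕜] H) (a T M : ℝ) (g : ℝ → H) (u₀ : A.domain) : Prop where
  continuousOn : ContinuousOn g (Icc 0 T)
  bound_zero : ∀ t ∈ Ioc 0 T, ‖A u₀ - g 0‖ + ‖g t‖ ≤ M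
  bound_deriv : ∃ g' g'' : ℝ → H, ∀ t ∈ Ioc 0 T,
    HasDerivWithinAt g (g' t) (Ioc 0 T) t ∧ HasDerivWithinAt g' (g'' t) (Ioc 0 T) t ∧
    ‖deriv (fun s : ℝ => expSemigroup A s (A u₀ - g 0)) t‖ + ‖g' t‖ + t * ‖g'' t‖
      ≤ M * t ^ (a - 1)

/-!
Write `R = A⁻¹`, let `ω_j(t) = t^{α_j-1} / Γ(α_j)` be the Abel kernels, `E(t) = exp(-tA)`, and let
`∗` be convolution on the half-line. By the bound with `q = 2`, `θ = 0`, the operators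
`S_j = B_j R` are bounded on `H`. The spectral theorem for the compact operator `R` provides a
functional calculus `φ ↦ φ(A)` (`funCalc`) in which uniform bounds on the spectrum are operator
bounds, and identities may be checked against eigenvectors of `A`, one eigenvalue `l` at a time.

Formally `w = A v` solves `w = E A u₀ + A E ∗ g + κ E ∗ w - ∑_j G_j ∗ S_j w` with
`G_j = A E ∗ ω_j`. The multiplier of `G_j(t)` is bounded by `C t^{α_j-1}` uniformly on the spectrum
(`abs_abelMultiplier_le`), so this is a weakly singular Volterra equation with bounded operators.
Differentiating it gives an equation of the same type for `q = A v'`, with right-hand side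
`-A E(t) (A u₀ - g(0)) + (A E ∗ g')(t) + κ E(t) A u₀ - ∑_j G_j(t) S_j A u₀`. Here `A E ∗ g'` is
`O(t^{a-1})` because the bound on `g''` makes `g'` locally Lipschitz, which compensates the
singularity `‖A E(t-s)‖ ≤ 1/(t-s)` (`weaklySingular_opSemigroupConv`).

The proof runs backwards through this computation. The equation for `q` is solved, with a bound, by
a fixed-point argument in the space of functions that are `O(t^{a-1})`, made contractive by an
exponential weight (`exists_volterra`). Mode by mode, variation of constants and the associativity
of convolution show that `R q` is continuously differentiable on `(0,T]`, with derivative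
`O(t^{a-1})`, and that `u₀ + ∫ R q` solves the equation of `v` (`exists_regular_solution`). Finally
the difference between `v` and this function, which is only known to be continuous with values in
`H`, solves the homogeneous problem; tested with eigenvectors this becomes a Volterra equation with
the adjoints of `S_j` in place of `S_j`, since `B_j` acts on `D(A)` weakly as `A S_j†`, and
uniqueness for that equation shows that the difference vanishes (`eq_zero_of_weak_solution`).
-/

/-! ### Spectral decomposition and functional calculus -/

section Spectral

variable {𝕜 H : Type*} [RCLike 𝕜] [NormedAddCommGroup H] [InnerProductSpace 𝕜 H]

theorem opApply_of_mem {A : H →ₗ.[𝕜] H} {x : H} (h : x ∈ A.domain) : opApply A x = A ⟨x, h⟩ :=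
  dif_pos h

theorem opApply_coe (A : H →ₗ.[𝕜] H) (x : A.domain) : opApply A x = A x :=
  opApply_of_mem x.2

theorem opApply_smul {A : H →ₗ.[𝕜] H} {x : H} (h : x ∈ A.domain) (c : 𝕜) :
    opApply A (c • x) = c • opApply A x := by
  rw [opApply_of_mem h, opApply_of_mem (A.domain.smul_mem c h), ← A.map_smul]; rfl

theorem mem_opEigenspace {A : H →ₗ.[𝕜] H} {l : ℝ} {x : H} :
    x ∈ opEigenspace A l ↔ x ∈ A.domain ∧ opApply A x = (l : 𝕜) • x := by
  constructor
  · rintro ⟨h, hx⟩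
    exact ⟨h, by rw [opApply_of_mem h, hx]⟩
  · rintro ⟨h, hx⟩
    exact ⟨h, by rw [← opApply_of_mem h, hx]⟩

variable [CompleteSpace H]

theorem inner_opApply_left {A : H →ₗ.[𝕜] H} (hA : IsSelfAdjoint A) {x y : H}
    (hx : x ∈ A.domain) (hy : y ∈ A.domain) :
    inner 𝕜 (opApply A x) y = inner 𝕜 x (opApply A y) := by
  have h := LinearPMap.adjoint_isFormalAdjoint (T := A) hA.dense_domain
  rw [LinearPMap.isSelfAdjoint_def.1 hA] at h
  rw [opApply_of_mem hx, opApply_of_mem hy]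
  exact h ⟨x, hx⟩ ⟨y, hy⟩

variable {A : H →ₗ.[𝕜] H}

/-- The bounded inverse `A⁻¹`. -/
noncomputable def IsPosDefWithCompactInverse.inv (hA : IsPosDefWithCompactInverse A) : H →L[𝕜] H :=
  hA.compact_inverse.choose

namespace IsPosDefWithCompactInverse

variable (hA : IsPosDefWithCompactInverse A)

include hA

theorem isCompactOperator_inv : IsCompactOperator hA.inv := hA.compact_inverse.choose_spec.1

theorem inv_mem (y : H) : hA.inv y ∈ A.domain := (hA.compact_inverse.choose_spec.2.1 y).1

theorem opApply_inv (y : H) : opApply A (hA.inv y) = y := by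
  rw [opApply_of_mem (hA.inv_mem y)]
  exact (hA.compact_inverse.choose_spec.2.1 y).2

theorem inv_opApply {x : H} (hx : x ∈ A.domain) : hA.inv (opApply A x) = x := by
  rw [opApply_of_mem hx]
  exact hA.compact_inverse.choose_spec.2.2 ⟨x, hx⟩

theorem inner_inv_left (x y : H) : inner 𝕜 (hA.inv x) y = inner 𝕜 x (hA.inv y) := by
  conv_lhs => rw [← hA.opApply_inv y]
  rw [← inner_opApply_left hA.selfAdjoint (hA.inv_mem x) (hA.inv_mem y), hA.opApply_inv]

theorem isSymmetric_inv : (hA.inv : H →ₗ[𝕜] H).IsSymmetric := hA.inner_inv_left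

theorem mem_opEigenspace_iff {l : ℝ} {x : H} :
    x ∈ opEigenspace A l ↔ x = (l : 𝕜) • hA.inv x := by
  rw [mem_opEigenspace]
  constructor
  · rintro ⟨h, hx⟩
    rw [← map_smul, ← hx, hA.inv_opApply h]
  · intro hx
    refine ⟨hx ▸ A.domain.smul_mem _ (hA.inv_mem x), ?_⟩
    conv_lhs => rw [hx]
    rw [opApply_smul (hA.inv_mem x), hA.opApply_inv]

theorem isClosed_opEigenspace (l : ℝ) : IsClosed (opEigenspace A l : Set H) := by
  have : (opEigenspace A l : Set H) = {x | x = (l : 𝕜) • hA.inv x} := by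
    ext x; exact hA.mem_opEigenspace_iff
  rw [this]
  exact isClosed_eq continuous_id (hA.inv.continuous.const_smul _)

theorem opEigenspace_topologicalClosure (l : ℝ) :
    (opEigenspace A l).topologicalClosure = opEigenspace A l :=
  (hA.isClosed_opEigenspace l).submodule_topologicalClosure_eq

theorem eq_zero_of_mem_opEigenspace {l : ℝ} (hl : l ≤ 0) {x : H} (hx : x ∈ opEigenspace A l) :
    x = 0 := by
  by_contra h0
  obtain ⟨h, hx⟩ := hx
  have := hA.pos ⟨x, h⟩ h0
  rw [hx, inner_smul_left, RCLike.conj_ofReal, RCLike.re_ofReal_mul, inner_self_eq_norm_sq] at this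
  nlinarith [sq_nonneg ‖x‖]

theorem orthogonalFamily_opEigenspace :
    OrthogonalFamily 𝕜 (fun l : ℝ => opEigenspace A l) fun l => (opEigenspace A l).subtypeₗᵢ := by
  intro l k hlk x y
  have hx := mem_opEigenspace.1 x.2
  have hy := mem_opEigenspace.1 y.2
  have h := inner_opApply_left hA.selfAdjoint hx.1 hy.1
  rw [hx.2, hy.2, inner_smul_left, inner_smul_right, RCLike.conj_ofReal, ← sub_eq_zero,
    ← sub_mul, mul_eq_zero, sub_eq_zero] at h
  exact h.resolve_left fun h => hlk (RCLike.ofReal_injective h)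

/-- The spectral theorem for `A`, from that for the compact operator `A⁻¹`; the latter is injective,
so that its eigenvalues are the inverses of those of `A`. -/
theorem iSup_opEigenspace_dense :
    ⊤ ≤ (⨆ l : ℝ, opEigenspace A l).topologicalClosure := by
  rw [top_le_iff, Submodule.topologicalClosure_eq_top_iff, eq_bot_iff,
    ← ContinuousLinearMap.orthogonalComplement_iSup_eigenspaces_eq_bot hA.isCompactOperator_inv
      hA.isSymmetric_inv]
  refine Submodule.orthogonal_le (iSup_le fun μ x hx => ?_)
  have hx' : hA.inv x = μ • x := Module.End.mem_eigenspace_iff.1 hx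
  rcases eq_or_ne x 0 with rfl | h0
  · exact zero_mem _
  have hμ0 : μ ≠ 0 := by
    rintro rfl
    rw [zero_smul] at hx'
    apply h0
    have h := opApply_smul A.domain.zero_mem (0 : 𝕜)
    rw [zero_smul, zero_smul] at h
    rw [← hA.opApply_inv x, hx', h]
  have hreal : (starRingEnd 𝕜) μ = μ :=
    hA.isSymmetric_inv.conj_eigenvalue_eq_self (μ := μ)
      (Module.End.hasEigenvalue_of_hasEigenvector ⟨hx, h0⟩)
  have hre : ((RCLike.re μ : ℝ) : 𝕜) = μ := RCLike.conj_eq_iff_re.1 hreal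
  refine Submodule.mem_iSup_of_mem (RCLike.re μ)⁻¹ (hA.mem_opEigenspace_iff.2 ?_)
  rw [hx', smul_smul, RCLike.ofReal_inv, hre, inv_mul_cancel₀ hμ0, one_smul]

theorem isHilbertSum_opEigenspace :
    IsHilbertSum 𝕜 (fun l : ℝ => opEigenspace A l) fun l => (opEigenspace A l).subtypeₗᵢ :=
  have : ∀ l : ℝ, CompleteSpace (opEigenspace A l) := fun l =>
    (hA.isClosed_opEigenspace l).completeSpace_coe
  IsHilbertSum.mkInternal (fun l : ℝ => opEigenspace A l) hA.orthogonalFamily_opEigenspace hA.iSup_opEigenspace_dense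

/-- Vectors are determined by their inner products with the eigenvectors of `A`. -/
theorem ext_inner_opEigenspace {x y : H}
    (h : ∀ l : ℝ, 0 < l → ∀ e ∈ opEigenspace A l, inner 𝕜 e x = inner 𝕜 e y) : x = y := by
  have hbot : (⨆ l : ℝ, opEigenspace A l)ᗮ = ⊥ :=
    Submodule.topologicalClosure_eq_top_iff.1 (top_le_iff.1 hA.iSup_opEigenspace_dense)
  have : x - y ∈ (⨆ l : ℝ, opEigenspace A l)ᗮ := by
    rw [← Submodule.iInf_orthogonal, Submodule.mem_iInf]
    intro l
    rw [Submodule.mem_orthogonal]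
    intro e he
    rcases lt_or_ge 0 l with hl | hl
    · rw [inner_sub_right, h l hl e he, sub_self]
    · rw [hA.eq_zero_of_mem_opEigenspace hl he, inner_zero_left]
  rwa [hbot, Submodule.mem_bot, sub_eq_zero] at this

theorem inner_inv_right {l : ℝ} {e : H} (hl : 0 < l) (he : e ∈ opEigenspace A l) (x : H) :
    inner 𝕜 e (hA.inv x) = (l : 𝕜)⁻¹ * inner 𝕜 e x := by
  have h := hA.mem_opEigenspace_iff.1 he
  conv_rhs => rw [h]
  have : (l : 𝕜) ≠ 0 := RCLike.ofReal_ne_zero.2 hl.ne'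
  rw [inner_smul_left, RCLike.conj_ofReal, inv_mul_cancel_left₀ this, hA.inner_inv_left]

/-- Multiplication by a function that is bounded on `(0,∞)` is a bounded operator: in the Hilbert
sum of the eigenspaces it is diagonal. Only positive eigenvalues occur. -/
theorem exists_multiplier (φ : ℝ → ℝ) {C : ℝ} (hC : 0 ≤ C) (hφ : ∀ l, 0 < l → |φ l| ≤ C) :
    ∃ L : H →L[𝕜] H, (∀ x, ‖L x‖ ≤ C * ‖x‖) ∧
      ∀ l, 0 < l → ∀ e ∈ opEigenspace A l, ∀ x, inner 𝕜 e (L x) = (φ l : 𝕜) * inner 𝕜 e x := by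
  classical
  let W := hA.isHilbertSum_opEigenspace.linearIsometryEquiv
  let ψ : ℝ → ℝ := fun l => if 0 < l then φ l else 0
  have hψ : ∀ l, |ψ l| ≤ C := fun l => by
    by_cases hl : 0 < l <;> simp [ψ, hl, hφ, hC]
  have hle : ∀ (f : lp (fun l : ℝ => opEigenspace A l) 2) (l : ℝ),
      ‖((ψ l : ℝ) : 𝕜) • f l‖ ≤ ‖(((C : ℝ) : 𝕜) • f) l‖ := fun f l => by
    rw [lp.coeFn_smul, Pi.smul_apply, norm_smul, norm_smul, RCLike.norm_ofReal, RCLike.norm_ofReal,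
      abs_of_nonneg hC]
    exact mul_le_mul_of_nonneg_right (hψ l) (norm_nonneg _)
  have hmem : ∀ f : lp (fun l : ℝ => opEigenspace A l) 2,
      Memℓp (fun l => ((ψ l : ℝ) : 𝕜) • f l) 2 := fun f => by
    have h := (lp.memℓp (((C : ℝ) : 𝕜) • f))
    rw [memℓp_gen_iff (by norm_num)] at h ⊢
    exact h.of_nonneg_of_le (fun l => by positivity)
      fun l => Real.rpow_le_rpow (norm_nonneg _) (hle f l) (by norm_num)
  let D : lp (fun l : ℝ => opEigenspace A l) 2 →ₗ[𝕜] lp (fun l : ℝ => opEigenspace A l) 2 :=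
    { toFun := fun f => ⟨_, hmem f⟩
      map_add' := fun f g => by ext l; simp only [lp.coeFn_add, Pi.add_apply, smul_add]
      map_smul' := fun c f => by ext l; simp [smul_comm c] }
  have hD : ∀ f, ‖D f‖ ≤ C * ‖f‖ := fun f => by
    have : ‖D f‖ ≤ ‖((C : ℝ) : 𝕜) • f‖ := lp.norm_mono (by norm_num) (hle f)
    rwa [norm_smul, RCLike.norm_ofReal, abs_of_nonneg hC] at this
  have hin : ∀ l, ∀ e : opEigenspace A l, ∀ f : lp (fun l : ℝ => opEigenspace A l) 2,
      inner 𝕜 (e : H) (W.symm f) = inner 𝕜 e (f l) := fun l e f => by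
    have : (e : H) = W.symm (lp.single 2 l e) := by
      rw [IsHilbertSum.linearIsometryEquiv_symm_apply_single]; rfl
    rw [this, LinearIsometryEquiv.inner_map_map, lp.inner_single_left]
  refine ⟨((W.symm.toLinearEquiv.toLinearMap.comp D).comp W.toLinearEquiv.toLinearMap).mkContinuous
    C fun x => ?_, fun x => ?_, fun l hl e he x => ?_⟩
  · simpa using hD (W x)
  · simpa using hD (W x)
  · have h1 := hin l ⟨e, he⟩ (D (W x))
    have h2 := hin l ⟨e, he⟩ (W x)
    rw [W.symm_apply_apply] at h2
    have h3 : D (W x) l = ((φ l : ℝ) : 𝕜) • (W x) l := by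
      change ((ψ l : ℝ) : 𝕜) • (W x) l = _
      simp [ψ, hl]
    rw [h3, inner_smul_right, ← h2] at h1
    simpa using h1

end IsPosDefWithCompactInverse

open scoped Classical in
/-- The operator `φ(A)`, acting as multiplication by `φ l` on the eigenspace of each `l > 0`; it is
`0` if there is no such bounded operator. -/
noncomputable def funCalc (A : H →ₗ.[𝕜] H) (φ : ℝ → ℝ) : H →L[𝕜] H :=
  if h : ∃ L : H →L[𝕜] H, ∀ l, 0 < l → ∀ e ∈ opEigenspace A l, ∀ x,
    inner 𝕜 e (L x) = (φ l : 𝕜) * inner 𝕜 e x then h.choose else 0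

namespace IsPosDefWithCompactInverse

variable (hA : IsPosDefWithCompactInverse A)

include hA

theorem inner_funCalc {φ : ℝ → ℝ} {C : ℝ} (hφ : ∀ l, 0 < l → |φ l| ≤ C) {l : ℝ} (hl : 0 < l) {e : H}
    (he : e ∈ opEigenspace A l) (x : H) :
    inner 𝕜 e (funCalc A φ x) = (φ l : 𝕜) * inner 𝕜 e x := by
  obtain ⟨L, -, hL⟩ := hA.exists_multiplier φ ((abs_nonneg _).trans (hφ 1 one_pos)) hφ
  have h : ∃ L : H →L[𝕜] H, ∀ l, 0 < l → ∀ e ∈ opEigenspace A l, ∀ x,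
    inner 𝕜 e (L x) = (φ l : 𝕜) * inner 𝕜 e x := ⟨L, hL⟩
  rw [funCalc, dif_pos h]
  exact h.choose_spec l hl e he x

theorem norm_funCalc_le {φ : ℝ → ℝ} {C : ℝ} (hφ : ∀ l, 0 < l → |φ l| ≤ C) :
    ‖funCalc A φ‖ ≤ C := by
  have hC := (abs_nonneg _).trans (hφ 1 one_pos)
  obtain ⟨L, hLC, hL⟩ := hA.exists_multiplier φ hC hφ
  refine ContinuousLinearMap.opNorm_le_bound _ hC fun x => ?_
  convert! hLC x using 2
  exact hA.ext_inner_opEigenspace fun l hl e he => by rw [hA.inner_funCalc hφ hl he, hL l hl e he]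

theorem funCalc_apply_eigenvector {φ : ℝ → ℝ} {C : ℝ} (hφ : ∀ l, 0 < l → |φ l| ≤ C) {l : ℝ}
    (hl : 0 < l) {e : H} (he : e ∈ opEigenspace A l) : funCalc A φ e = (φ l : 𝕜) • e := by
  refine hA.ext_inner_opEigenspace fun k hk e' he' => ?_
  rw [hA.inner_funCalc hφ hk he', inner_smul_right]
  rcases eq_or_ne k l with rfl | hkl
  · rfl
  · have : inner 𝕜 e' e = 0 := hA.orthogonalFamily_opEigenspace hkl ⟨e', he'⟩ ⟨e, he⟩
    rw [this, mul_zero, mul_zero]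

/-- A uniformly bounded family of multipliers that is pointwise continuous in a parameter is
strongly continuous: strong continuity holds on the eigenvectors, whose span is dense. -/
theorem continuousOn_funCalc_apply {X : Type*} [TopologicalSpace X] {s : Set X} {φ : X → ℝ → ℝ}
    {C : ℝ} (hφ : ∀ t ∈ s, ∀ l, 0 < l → |φ t l| ≤ C)
    (hc : ∀ l, 0 < l → ContinuousOn (fun t => φ t l) s) (x : H) :
    ContinuousOn (fun t => funCalc A (φ t) x) s := by
  rcases s.eq_empty_or_nonempty with rfl | ⟨t₀, ht₀⟩
  · exact continuousOn_empty _
  have hC := (abs_nonneg _).trans (hφ t₀ ht₀ 1 one_pos)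
  let S : Submodule 𝕜 H :=
    { carrier := {x | ContinuousOn (fun t => funCalc A (φ t) x) s}
      zero_mem' := by simpa using continuousOn_const
      add_mem' := fun {x y} hx hy => by
        simp only [Set.mem_ofPred_eq, map_add] at hx hy ⊢; exact hx.add hy
      smul_mem' := fun c x hx => by
        simp only [Set.mem_ofPred_eq, map_smul] at hx ⊢; exact hx.const_smul c }
  have hS : (⨆ l : ℝ, opEigenspace A l) ≤ S := by
    refine iSup_le fun l e he => ?_
    rcases lt_or_ge 0 l with hl | hl
    · change ContinuousOn (fun t => funCalc A (φ t) e) s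
      have : ContinuousOn (fun t => ((φ t l : ℝ) : 𝕜) • e) s :=
        (RCLike.continuous_ofReal.comp_continuousOn (hc l hl)).smul continuousOn_const
      exact this.congr fun t ht => hA.funCalc_apply_eigenvector (hφ t ht) hl he
    · rw [hA.eq_zero_of_mem_opEigenspace hl he]; exact S.zero_mem
  have hx : x ∈ (⨆ l : ℝ, opEigenspace A l).topologicalClosure :=
    hA.iSup_opEigenspace_dense trivial
  rw [← SetLike.mem_coe, Submodule.topologicalClosure_coe, Metric.mem_closure_iff] at hx
  refine continuousOn_of_uniform_approx_of_continuousOn fun u hu => ?_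
  obtain ⟨ε, hε, hεu⟩ := Metric.mem_uniformity_dist.1 hu
  obtain ⟨y, hy, hxy⟩ := hx (ε / (C + 1)) (by positivity)
  refine ⟨fun t => funCalc A (φ t) y, hS hy, fun t ht => hεu ?_⟩
  rw [dist_eq_norm, ← map_sub]
  calc _ ≤ C * ‖x - y‖ := ContinuousLinearMap.le_of_opNorm_le _ (hA.norm_funCalc_le (hφ t ht)) _
    _ ≤ (C + 1) * ‖x - y‖ := by gcongr; linarith
    _ < (C + 1) * (ε / (C + 1)) := by gcongr; rwa [← dist_eq_norm]
    _ = ε := by field_simp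

/-- The semigroup is the function `l ↦ e^{-lt}` of `A`. -/
theorem expSemigroup_eq {t : ℝ} (ht : 0 ≤ t) (w : H) :
    expSemigroup A t w = funCalc A (fun l => Real.exp (-(l * t))) w := by
  classical
  have hφ : ∀ l, 0 < l → |Real.exp (-(l * t))| ≤ 1 := fun l hl => by
    rw [abs_of_pos (Real.exp_pos _), Real.exp_le_one_iff]
    nlinarith
  set z := funCalc A (fun l => Real.exp (-(l * t))) w with hz
  let W := hA.isHilbertSum_opEigenspace.linearIsometryEquiv
  have h := hA.isHilbertSum_opEigenspace.hasSum_linearIsometryEquiv_symm (W z)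
  rw [LinearIsometryEquiv.symm_apply_apply] at h
  rw [← h.tsum_eq, expSemigroup]
  refine tsum_congr fun l => ?_
  have : CompleteSpace (opEigenspace A l) := (hA.isClosed_opEigenspace l).completeSpace_coe
  have hin : ∀ e ∈ opEigenspace A l, inner 𝕜 e (((W z) l : opEigenspace A l) : H) = inner 𝕜 e z := by
    intro e he
    have : e = W.symm (lp.single 2 l ⟨e, he⟩) := by
      rw [IsHilbertSum.linearIsometryEquiv_symm_apply_single]; rfl
    conv_rhs => rw [this, ← W.symm_apply_apply z]
    rw [LinearIsometryEquiv.inner_map_map, lp.inner_single_left]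
    rfl
  simp only [opEigenspace_topologicalClosure hA]
  change _ = (((W z) l : opEigenspace A l) : H)
  rcases lt_or_ge 0 l with hl | hl
  · have hmem : (((Real.exp (-(l * t)) : ℝ) : 𝕜) • (opEigenspace A l).starProjection w)
      - (((W z) l : opEigenspace A l) : H) ∈ opEigenspace A l :=
      Submodule.sub_mem _ (Submodule.smul_mem _ _ (Submodule.starProjection_apply_mem _ _)) (Subtype.prop _)
    rw [← sub_eq_zero, ← inner_self_eq_zero (𝕜 := 𝕜)]
    set e := (((Real.exp (-(l * t)) : ℝ) : 𝕜) • (opEigenspace A l).starProjection w)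
      - (((W z) l : opEigenspace A l) : H) with he
    conv_lhs => rw [he]
    rw [← he, inner_sub_right, hin e hmem, inner_smul_right, hz, hA.inner_funCalc hφ hl hmem,
      ← Submodule.inner_starProjection_left_eq_right,
      Submodule.starProjection_eq_self_iff.2 hmem, sub_self]
  · rw [hA.eq_zero_of_mem_opEigenspace hl (Subtype.prop ((W z) l)),
      hA.eq_zero_of_mem_opEigenspace hl (Submodule.starProjection_apply_mem _ w), smul_zero]

end IsPosDefWithCompactInverse

end Spectral

/-! ### Weakly singular convolutions -/

section WeaklySingular

open MeasureTheory Filter Topology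

variable {E F : Type*} [NormedAddCommGroup E] [NormedAddCommGroup F]

/-- Continuity of a parameter integral over `(0,1)` whose integrand has a separated majorant. -/
theorem continuousOn_integral_of_le_mul [NormedSpace ℝ F] {X : Type*} [TopologicalSpace X] [FirstCountableTopology X]
    {s : Set X} {J : X → ℝ → F} {b : X → ℝ} {ρ : ℝ → ℝ}
    (hJ : ContinuousOn (fun p : X × ℝ => J p.1 p.2) (s ×ˢ Ioo 0 1))
    (hb : ContinuousOn b s) (hρ : IntervalIntegrable ρ volume 0 1)
    (hρ0 : ∀ σ ∈ Ioo (0 : ℝ) 1, 0 ≤ ρ σ)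
    (hle : ∀ t ∈ s, ∀ σ ∈ Ioo (0 : ℝ) 1, ‖J t σ‖ ≤ b t * ρ σ) :
    ContinuousOn (fun t => ∫ σ in (0 : ℝ)..1, J t σ) s := by
  intro t₀ ht₀
  have hae : ∀ᵐ σ : ℝ, σ ∈ uIoc (0 : ℝ) 1 → σ ∈ Ioo (0 : ℝ) 1 := by
    have : ∀ᵐ σ : ℝ, σ ≠ 1 := by simp [ae_iff, measure_singleton]
    filter_upwards [this] with σ h1 h
    rw [uIoc_of_le zero_le_one] at h
    exact ⟨h.1, lt_of_le_of_ne h.2 h1⟩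
  refine intervalIntegral.continuousWithinAt_of_dominated_interval
    (bound := fun σ => (b t₀ + 1) * ρ σ) ?_ ?_ (hρ.const_mul _) ?_
  · filter_upwards [self_mem_nhdsWithin] with t ht
    rw [uIoc_of_le zero_le_one, ← restrict_Ioo_eq_restrict_Ioc]
    refine ContinuousOn.aestronglyMeasurable ?_ measurableSet_Ioo
    exact hJ.comp (f := fun σ : ℝ => (t, σ)) (by fun_prop) fun σ hσ => ⟨ht, hσ⟩
  · have : ∀ᶠ t in 𝓝[s] t₀, b t < b t₀ + 1 := (hb t₀ ht₀).eventually (gt_mem_nhds (lt_add_one _))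
    filter_upwards [self_mem_nhdsWithin, this] with t ht hbt
    filter_upwards [hae] with σ hσ h
    exact (hle t ht σ (hσ h)).trans (mul_le_mul_of_nonneg_right hbt.le (hρ0 σ (hσ h)))
  · filter_upwards [hae] with σ hσ h
    exact (hJ (t₀, σ) ⟨ht₀, hσ h⟩).comp (f := fun t => (t, σ)) (by fun_prop)
      fun t ht => ⟨ht, hσ h⟩

/-- The Euler beta integral `∫₀¹ σ^{a-1} (1-σ)^{b-1} dσ`. -/
noncomputable def betaInt (a b : ℝ) : ℝ := ∫ σ in (0 : ℝ)..1, σ ^ (a - 1) * (1 - σ) ^ (b - 1)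

theorem intervalIntegrable_beta {a b : ℝ} (ha : 0 < a) (hb : 0 < b) :
    IntervalIntegrable (fun σ : ℝ => σ ^ (a - 1) * (1 - σ) ^ (b - 1)) volume 0 1 := by
  have h := Complex.betaIntegral_convergent (u := a) (v := b) (by simpa) (by simpa)
  rw [intervalIntegrable_iff_integrableOn_Ioc_of_le zero_le_one] at h ⊢
  refine h.re.congr ?_
  filter_upwards [ae_restrict_mem measurableSet_Ioc] with x hx
  norm_cast
  rw [← Complex.ofReal_cpow hx.1.le, ← Complex.ofReal_cpow (by linarith [hx.2]),
    ← Complex.ofReal_mul]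
  simp

theorem betaInt_nonneg (a b : ℝ) : 0 ≤ betaInt a b :=
  intervalIntegral.integral_nonneg zero_le_one fun σ hσ =>
    mul_nonneg (Real.rpow_nonneg hσ.1 _) (Real.rpow_nonneg (by linarith [hσ.2]) _)

theorem beta_scale {a b t σ : ℝ} (ht : 0 < t) (hσ : σ ∈ Icc (0 : ℝ) 1) :
    (t * σ) ^ (a - 1) * (t - t * σ) ^ (b - 1) =
      t ^ (a + b - 2) * (σ ^ (a - 1) * (1 - σ) ^ (b - 1)) := by
  rw [show t - t * σ = t * (1 - σ) by ring, Real.mul_rpow ht.le hσ.1,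
    Real.mul_rpow ht.le (by linarith [hσ.2]), show a + b - 2 = (a - 1) + (b - 1) by ring,
    Real.rpow_add ht]
  ring

theorem intervalIntegrable_beta_scaled {a b t : ℝ} (ha : 0 < a) (hb : 0 < b) (ht : 0 < t) :
    IntervalIntegrable (fun s : ℝ => s ^ (a - 1) * (t - s) ^ (b - 1)) volume 0 t := by
  have h : IntervalIntegrable (fun σ : ℝ => (t * σ) ^ (a - 1) * (t - t * σ) ^ (b - 1)) volume
      (0 / t) (t / t) := by
    rw [zero_div, div_self ht.ne']
    refine ((intervalIntegrable_beta ha hb).const_mul (t ^ (a + b - 2))).congr fun σ hσ => ?_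
    rw [uIoc_of_le zero_le_one] at hσ
    exact (beta_scale ht ⟨hσ.1.le, hσ.2⟩).symm
  exact (IntervalIntegrable.comp_mul_left_iff ht.ne'
    (f := fun s : ℝ => s ^ (a - 1) * (t - s) ^ (b - 1))).1 h

theorem integral_beta_scaled {a b t : ℝ} (ht : 0 < t) :
    ∫ s in (0 : ℝ)..t, s ^ (a - 1) * (t - s) ^ (b - 1) = betaInt a b * t ^ (a + b - 1) := by
  have h := intervalIntegral.smul_integral_comp_mul_left (a := 0) (b := 1)
    (fun s : ℝ => s ^ (a - 1) * (t - s) ^ (b - 1)) t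
  rw [mul_zero, mul_one] at h
  rw [← h, intervalIntegral.integral_congr (g := fun σ => t ^ (a + b - 2) *
      (σ ^ (a - 1) * (1 - σ) ^ (b - 1))) fun σ hσ => beta_scale ht (by rwa [uIcc_of_le zero_le_one] at hσ),
    intervalIntegral.integral_const_mul, smul_eq_mul, ← mul_assoc, betaInt, mul_comm (∫ σ in _.._, _)]
  congr 1
  rw [show a + b - 1 = 1 + (a + b - 2) by ring, Real.rpow_add ht, Real.rpow_one]

theorem ae_mem_Ioo_of_mem_Ioc (t : ℝ) : ∀ᵐ s : ℝ, s ∈ Ioc (0 : ℝ) t → s ∈ Ioo (0 : ℝ) t := by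
  have : ∀ᵐ σ : ℝ, σ ≠ t := by simp [ae_iff, measure_singleton]
  filter_upwards [this] with σ h1 h
  exact ⟨h.1, lt_of_le_of_ne h.2 h1⟩

theorem intervalIntegrable_of_continuousOn_of_le {f : ℝ → F} {ρ : ℝ → ℝ} {t : ℝ} (ht : 0 ≤ t)
    (hf : ContinuousOn f (Ioo 0 t)) (hρ : IntervalIntegrable ρ volume 0 t)
    (hle : ∀ s ∈ Ioo 0 t, ‖f s‖ ≤ ρ s) : IntervalIntegrable f volume 0 t := by
  rw [intervalIntegrable_iff_integrableOn_Ioo_of_le ht] at hρ ⊢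
  refine Integrable.mono' hρ (hf.aestronglyMeasurable measurableSet_Ioo) ?_
  filter_upwards [ae_restrict_mem measurableSet_Ioo] with s hs
  exact hle s hs

theorem norm_intervalIntegral_le_of_Ioo [NormedSpace ℝ F] {f : ℝ → F} {ρ : ℝ → ℝ} {t : ℝ} (ht : 0 ≤ t)
    (hρ : IntervalIntegrable ρ volume 0 t)
    (hle : ∀ s ∈ Ioo 0 t, ‖f s‖ ≤ ρ s) : ‖∫ s in (0 : ℝ)..t, f s‖ ≤ ∫ s in (0 : ℝ)..t, ρ s := by
  refine intervalIntegral.norm_integral_le_of_norm_le ht ?_ hρ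
  filter_upwards [ae_mem_Ioo_of_mem_Ioc t] with s h hs
  exact hle s (h hs)

/-- `x` is continuous on `(0,T]` and `‖x(t)‖ ≤ C t^{a-1}` there. -/
structure WeaklySingular (a C T : ℝ) (x : ℝ → E) : Prop where
  continuousOn : ContinuousOn x (Ioc 0 T)
  bound : ∀ t ∈ Ioc 0 T, ‖x t‖ ≤ C * t ^ (a - 1)

theorem WeaklySingular.intervalIntegrable {x : ℝ → F} {a C T t : ℝ} (hx : WeaklySingular a C T x)
    (ha : 0 < a) (ht : t ∈ Icc 0 T) : IntervalIntegrable x volume 0 t :=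
  intervalIntegrable_of_continuousOn_of_le ht.1
    (hx.continuousOn.mono fun s hs => ⟨hs.1, hs.2.le.trans ht.2⟩)
    ((intervalIntegral.intervalIntegrable_rpow' (by linarith)).const_mul C)
    fun s hs => hx.bound s ⟨hs.1, hs.2.le.trans ht.2⟩

/-- A jointly continuous kernel `N : (0,T] × E → F` with `‖N(r,x)‖ ≤ K r^{b-1} ‖x‖`. -/
structure WeaklySingularKernel (b K T : ℝ) (N : ℝ → E → F) : Prop where
  continuousOn : ContinuousOn (fun p : ℝ × E => N p.1 p.2) (Ioc 0 T ×ˢ univ)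
  bound : ∀ r ∈ Ioc 0 T, ∀ x, ‖N r x‖ ≤ K * r ^ (b - 1) * ‖x‖

section

variable {a b C K T : ℝ} {N : ℝ → E → F} {x : ℝ → E}

theorem WeaklySingularKernel.norm_le (hN : WeaklySingularKernel b K T N)
    (hx : WeaklySingular a C T x) (hK : 0 ≤ K) {t : ℝ} (ht : t ∈ Ioc 0 T) {s : ℝ}
    (hs : s ∈ Ioo 0 t) :
    ‖N (t - s) (x s)‖ ≤ K * C * (s ^ (a - 1) * (t - s) ^ (b - 1)) := by
  have h1 : 0 < t - s := sub_pos.2 hs.2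
  calc _ ≤ K * (t - s) ^ (b - 1) * ‖x s‖ :=
        hN.bound _ ⟨h1, by linarith [hs.1, ht.2]⟩ _
    _ ≤ K * (t - s) ^ (b - 1) * (C * s ^ (a - 1)) := by
        gcongr
        exact hx.bound s ⟨hs.1, hs.2.le.trans ht.2⟩
    _ = _ := by ring

theorem WeaklySingularKernel.continuousOn_integrand (hN : WeaklySingularKernel b K T N)
    (hx : ContinuousOn x (Ioc 0 T)) {t : ℝ} (ht : t ∈ Ioc 0 T) :
    ContinuousOn (fun s => N (t - s) (x s)) (Ioo 0 t) := by
  refine hN.continuousOn.comp (f := fun s => (t - s, x s)) (ContinuousOn.prodMk (by fun_prop) ?_) ?_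
  · exact hx.mono fun s hs => ⟨hs.1, hs.2.le.trans ht.2⟩
  · exact fun s hs => ⟨⟨sub_pos.2 hs.2, by linarith [hs.1, ht.2]⟩, mem_univ _⟩

theorem WeaklySingularKernel.intervalIntegrable (hN : WeaklySingularKernel b K T N)
    (hx : WeaklySingular a C T x) (hK : 0 ≤ K) (ha : 0 < a) (hb : 0 < b) {t : ℝ}
    (ht : t ∈ Ioc 0 T) : IntervalIntegrable (fun s => N (t - s) (x s)) volume 0 t :=
  intervalIntegrable_of_continuousOn_of_le ht.1.le (hN.continuousOn_integrand hx.continuousOn ht)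
    ((intervalIntegrable_beta_scaled ha hb ht.1).const_mul _) fun _ hs => hN.norm_le hx hK ht hs

/-- The convolution of two weakly singular functions is weakly singular; the orders add up. -/
theorem WeaklySingularKernel.weaklySingular [NormedSpace ℝ F] (hN : WeaklySingularKernel b K T N)
    (hx : WeaklySingular a C T x) (hK : 0 ≤ K) (ha : 0 < a) (hb : 0 < b) :
    WeaklySingular (a + b) (K * C * betaInt a b) T fun t => ∫ s in (0 : ℝ)..t, N (t - s) (x s) := by
  constructor
  · -- after the substitution `s = t σ` the domain of integration no longer depends on `t`
    have hcongr : ∀ t, (∫ s in (0 : ℝ)..t, N (t - s) (x s)) =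
        ∫ σ in (0 : ℝ)..1, t • N (t - t * σ) (x (t * σ)) := fun t => by
      rw [intervalIntegral.integral_smul]
      have := intervalIntegral.smul_integral_comp_mul_left (a := 0) (b := 1)
        (fun s : ℝ => N (t - s) (x s)) t
      rw [this, mul_zero, mul_one]
    simp only [hcongr]
    have hmem : ∀ p ∈ Ioc (0 : ℝ) T ×ˢ Ioo (0 : ℝ) 1,
        p.1 * p.2 ∈ Ioo 0 p.1 := fun p hp =>
      ⟨mul_pos hp.1.1 hp.2.1, mul_lt_of_lt_one_right hp.1.1 hp.2.2⟩
    refine continuousOn_integral_of_le_mul (b := fun t => t * (K * C * t ^ (a + b - 2)))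
      (ρ := fun σ => σ ^ (a - 1) * (1 - σ) ^ (b - 1)) ?_ ?_
      (intervalIntegrable_beta ha hb) ?_ ?_
    · refine ContinuousOn.smul (by fun_prop) (hN.continuousOn.comp
        (f := fun p : ℝ × ℝ => (p.1 - p.1 * p.2, x (p.1 * p.2)))
        (ContinuousOn.prodMk (by fun_prop) (hx.continuousOn.comp (by fun_prop) ?_)) ?_)
      · exact fun p hp => ⟨(hmem p hp).1, (hmem p hp).2.le.trans hp.1.2⟩
      · exact fun p hp => ⟨⟨sub_pos.2 (hmem p hp).2, by linarith [(hmem p hp).1, hp.1.2]⟩,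
          mem_univ _⟩
    · refine continuousOn_id.mul (continuousOn_const.mul ?_)
      exact ContinuousOn.rpow_const (by fun_prop) fun t ht => Or.inl ht.1.ne'
    · exact fun σ hσ => mul_nonneg (Real.rpow_nonneg hσ.1.le _)
        (Real.rpow_nonneg (by linarith [hσ.2]) _)
    · intro t ht σ hσ
      have := hN.norm_le hx hK ht (hmem (t, σ) ⟨ht, hσ⟩)
      rw [beta_scale ht.1 ⟨hσ.1.le, hσ.2.le⟩] at this
      rw [norm_smul, Real.norm_of_nonneg ht.1.le, mul_assoc t]
      gcongr
      · exact ht.1.le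
      · linarith
  · intro t ht
    calc _ ≤ ∫ s in (0 : ℝ)..t, K * C * (s ^ (a - 1) * (t - s) ^ (b - 1)) :=
          norm_intervalIntegral_le_of_Ioo ht.1.le
            ((intervalIntegrable_beta_scaled ha hb ht.1).const_mul _)
            fun _ hs => hN.norm_le hx hK ht hs
      _ = _ := by
          rw [intervalIntegral.integral_const_mul, integral_beta_scaled ht.1]
          ring

theorem WeaklySingular.mono {C' a' : ℝ} (hx : WeaklySingular a C T x) (ha : a' ≤ a) (hC : 0 ≤ C)
    (hC' : C * T ^ (a - a') ≤ C') : WeaklySingular a' C' T x := by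
  refine ⟨hx.continuousOn, fun t ht => (hx.bound t ht).trans ?_⟩
  rw [show a - 1 = (a - a') + (a' - 1) by ring, Real.rpow_add ht.1, ← mul_assoc]
  have : t ^ (a - a') ≤ T ^ (a - a') := Real.rpow_le_rpow ht.1.le ht.2 (by linarith)
  have h2 : 0 ≤ t ^ (a' - 1) := Real.rpow_nonneg ht.1.le _
  exact mul_le_mul_of_nonneg_right ((mul_le_mul_of_nonneg_left this hC).trans hC') h2

end

/-! ### Weakly singular Volterra equations -/

section Volterra

variable {H : Type*} [NormedAddCommGroup H] [NormedSpace ℝ H] {a K T : ℝ} {k : ℝ → H → H}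

/-- The exponential weight `e^{μt}` with large `μ` makes a weakly singular Volterra operator a
contraction by the factor `1/2`. -/
theorem exists_exp_weight (ha : 0 < a) (ha1 : a ≤ 1) (hT : 0 < T) (K : ℝ) (hK : 0 ≤ K) :
    ∃ μ : ℝ, 0 < μ ∧ ∀ (k : ℝ → H → H), WeaklySingularKernel a K T k →
      ∀ (C : ℝ) (x : ℝ → H), 0 ≤ C →
      (∀ s ∈ Ioc 0 T, ‖x s‖ ≤ C * (s ^ (a - 1) * Real.exp (μ * s))) →
      ∀ t ∈ Ioc 0 T, ‖∫ s in (0 : ℝ)..t, k (t - s) (x s)‖ ≤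
        C / 2 * (t ^ (a - 1) * Real.exp (μ * t)) := by
  set D := K * betaInt a (a / 2) * T ^ (a / 2) with hD
  have hD0 : 0 ≤ D := mul_nonneg (mul_nonneg hK (betaInt_nonneg _ _)) (Real.rpow_nonneg hT.le _)
  -- `μ` is chosen so that `μ ^ (a / 2) = 2 * D + 1`
  set μ := (2 * D + 1) ^ (2 / a) with hμ
  have hμ0 : 0 < μ := Real.rpow_pos_of_pos (by linarith) _
  have hμa : μ ^ (a / 2) = 2 * D + 1 := by
    rw [hμ, ← Real.rpow_mul (by linarith), show 2 / a * (a / 2) = 1 by field_simp, Real.rpow_one]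
  refine ⟨μ, hμ0, fun k hk C x hC hx t ht => ?_⟩
  have hpt : ∀ s ∈ Ioo 0 t, ‖k (t - s) (x s)‖ ≤ K * C * Real.exp (μ * t) / (2 * D + 1) *
      (s ^ (a - 1) * (t - s) ^ (a / 2 - 1)) := by
    intro s hs
    have h1 : 0 < t - s := sub_pos.2 hs.2
    have hx' := hx s ⟨hs.1, hs.2.le.trans ht.2⟩
    have hexp : Real.exp (μ * s) * (t - s) ^ (a / 2) ≤ Real.exp (μ * t) / (2 * D + 1) := by
      rw [le_div_iff₀ (by linarith), ← hμa, mul_assoc, ← Real.mul_rpow h1.le hμ0.le]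
      have h2 : ((t - s) * μ) ^ (a / 2) ≤ Real.exp ((t - s) * μ) := by
        have h3 : 0 < (t - s) * μ := mul_pos h1 hμ0
        rcases le_total ((t - s) * μ) 1 with h4 | h4
        · exact (Real.rpow_le_one h3.le h4 (by linarith)).trans (Real.one_le_exp h3.le)
        · refine (Real.rpow_le_rpow_of_exponent_le h4 (show a / 2 ≤ 1 by linarith)).trans ?_
          rw [Real.rpow_one]
          linarith [Real.add_one_le_exp ((t - s) * μ)]
      calc _ ≤ Real.exp (μ * s) * Real.exp ((t - s) * μ) := by gcongr
        _ = _ := by rw [← Real.exp_add]; ring_nf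
    have hs0 : 0 ≤ s ^ (a - 1) := Real.rpow_nonneg hs.1.le _
    have hts0 : 0 ≤ (t - s) ^ (a / 2 - 1) := Real.rpow_nonneg h1.le _
    calc _ ≤ K * (t - s) ^ (a - 1) * ‖x s‖ := hk.bound _ ⟨h1, by linarith [hs.1, ht.2]⟩ _
      _ ≤ K * (t - s) ^ (a - 1) * (C * (s ^ (a - 1) * Real.exp (μ * s))) := by gcongr
      _ = K * C * (Real.exp (μ * s) * (t - s) ^ (a / 2)) *
          (s ^ (a - 1) * (t - s) ^ (a / 2 - 1)) := by
          rw [show a - 1 = a / 2 + (a / 2 - 1) by ring, Real.rpow_add h1]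
          ring
      _ ≤ K * C * (Real.exp (μ * t) / (2 * D + 1)) *
          (s ^ (a - 1) * (t - s) ^ (a / 2 - 1)) := by gcongr
      _ = _ := by ring
  have hint := intervalIntegrable_beta_scaled ha (half_pos ha) ht.1
  refine (norm_intervalIntegral_le_of_Ioo ht.1.le (hint.const_mul _) hpt).trans ?_
  rw [intervalIntegral.integral_const_mul, integral_beta_scaled ht.1,
    show a + a / 2 - 1 = (a - 1) + a / 2 by ring, Real.rpow_add ht.1]
  have hta : t ^ (a / 2) ≤ T ^ (a / 2) := Real.rpow_le_rpow ht.1.le ht.2 (by linarith)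
  have h0 : 0 ≤ t ^ (a - 1) := Real.rpow_nonneg ht.1.le _
  have hB := betaInt_nonneg a (a / 2)
  have hfrac : (K * betaInt a (a / 2) * t ^ (a / 2)) / (2 * D + 1) ≤ 1 / 2 := by
    refine (div_le_div_iff₀ (by linarith) two_pos).2 ?_
    have : K * betaInt a (a / 2) * t ^ (a / 2) ≤ D := by
      rw [hD]; gcongr
    linarith
  calc _ = C * Real.exp (μ * t) * t ^ (a - 1) *
        ((K * betaInt a (a / 2) * t ^ (a / 2)) / (2 * D + 1)) := by
        ring
    _ ≤ C * Real.exp (μ * t) * t ^ (a - 1) * (1 / 2) :=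
        mul_le_mul_of_nonneg_left hfrac (by positivity)
    _ = _ := by ring

/-- Uniqueness for homogeneous weakly singular Volterra equations. -/
theorem eq_zero_of_volterra (ha : 0 < a) (ha1 : a ≤ 1) (hK : 0 ≤ K) (hk : WeaklySingularKernel a K T k)
    {C : ℝ} {x : ℝ → H} (hxb : WeaklySingular a C T x)
    (hx : ∀ t ∈ Ioc 0 T, x t = ∫ s in (0 : ℝ)..t, k (t - s) (x s)) : ∀ t ∈ Ioc 0 T, x t = 0 := by
  intro t ht
  have hT : 0 < T := ht.1.trans_le ht.2
  obtain ⟨μ, hμ, h⟩ := exists_exp_weight (H := H) ha ha1 hT K hK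
  have hC : 0 ≤ C := by
    have := (norm_nonneg _).trans (hxb.bound t ht)
    exact nonneg_of_mul_nonneg_left this (Real.rpow_pos_of_pos ht.1 _)
  have key : ∀ n : ℕ, ∀ s ∈ Ioc 0 T, ‖x s‖ ≤ C / 2 ^ n * (s ^ (a - 1) * Real.exp (μ * s)) := by
    intro n
    induction n with
    | zero =>
      intro s hs
      rw [pow_zero, div_one]
      refine (hxb.bound s hs).trans ?_
      gcongr
      exact le_mul_of_one_le_right (Real.rpow_nonneg hs.1.le _)
        (Real.one_le_exp (mul_pos hμ hs.1).le)
    | succ n ih =>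
      intro s hs
      rw [hx s hs, pow_succ, ← div_div]
      exact h k hk _ x (by positivity) ih s hs
  have hlim : Tendsto (fun n : ℕ => C / 2 ^ n * (t ^ (a - 1) * Real.exp (μ * t))) atTop (𝓝 0) := by
    have := (tendsto_pow_atTop_nhds_zero_of_lt_one (r := (1 / 2 : ℝ)) (by norm_num)
      (by norm_num)).const_mul (C * (t ^ (a - 1) * Real.exp (μ * t)))
    rw [mul_zero] at this
    refine this.congr fun n => ?_
    rw [div_pow, one_pow]; ring
  exact norm_le_zero_iff.1 (ge_of_tendsto' hlim fun n => key n t ht)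

/-- Existence for weakly singular Volterra equations, with a bound. -/
theorem exists_volterra [CompleteSpace H] (ha : 0 < a) (ha1 : a ≤ 1) (hT : 0 < T) (K : ℝ) (hK : 0 ≤ K) :
    ∃ D : ℝ, 0 ≤ D ∧ ∀ (k : ℝ → H → H), WeaklySingularKernel a K T k →
      (∀ r x y, k r (x - y) = k r x - k r y) → ∀ (C : ℝ) (h : ℝ → H), 0 ≤ C →
      WeaklySingular a C T h → ∃ x : ℝ → H, WeaklySingular a (D * C) T x ∧
        ∀ t ∈ Ioc 0 T, x t = h t + ∫ s in (0 : ℝ)..t, k (t - s) (x s) := by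
  obtain ⟨μ, hμ, hμk⟩ := exists_exp_weight (H := H) ha ha1 hT K hK
  refine ⟨2 * Real.exp (μ * T), by positivity, fun k hk hlin C h hC hh => ?_⟩
  -- the weight, and its inverse
  set ρ : ℝ → ℝ := fun t => t ^ (a - 1) * Real.exp (μ * t) with hρ
  have hρ0 : ∀ t ∈ Ioc 0 T, 0 < ρ t := fun t ht =>
    mul_pos (Real.rpow_pos_of_pos ht.1 _) (Real.exp_pos _)
  have hρc : ContinuousOn ρ (Ioc 0 T) :=
    (ContinuousOn.rpow_const (by fun_prop) fun t ht => Or.inl ht.1.ne').mul (by fun_prop)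
  have hρle : ∀ t ∈ Ioc 0 T, ρ t ≤ Real.exp (μ * T) * t ^ (a - 1) := fun t ht => by
    have := ht.2
    have h0 := Real.rpow_nonneg ht.1.le (a - 1)
    change t ^ (a - 1) * Real.exp (μ * t) ≤ _
    rw [mul_comm]
    gcongr
  have hρge : ∀ t ∈ Ioc 0 T, t ^ (a - 1) ≤ ρ t := fun t ht =>
    le_mul_of_one_le_right (Real.rpow_nonneg ht.1.le _) (Real.one_le_exp (mul_pos hμ ht.1).le)
  classical
  let ext : (BoundedContinuousFunction (Ioc (0 : ℝ) T) H) → ℝ → H := fun p s =>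
    if hs : s ∈ Ioc 0 T then ρ s • p ⟨s, hs⟩ else 0
  have ext_of : ∀ p (t : Ioc (0 : ℝ) T), ext p t = ρ t • p t := fun p t => dif_pos t.2
  have ext_cont : ∀ p, ContinuousOn (ext p) (Ioc 0 T) := fun p => by
    rw [continuousOn_iff_continuous_domRestrict]
    have : (Ioc 0 T).domRestrict (ext p) = fun t : Ioc (0 : ℝ) T => ρ t • p t :=
      funext fun t => ext_of p t
    rw [this]
    exact (continuousOn_iff_continuous_domRestrict.1 hρc).smul p.continuous
  have ext_bd : ∀ p, ∀ t ∈ Ioc 0 T, ‖ext p t‖ ≤ ‖p‖ * ρ t := fun p t ht => by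
    rw [ext_of p ⟨t, ht⟩, norm_smul, Real.norm_of_nonneg (hρ0 t ht).le, mul_comm]
    exact mul_le_mul_of_nonneg_right (p.norm_coe_le_norm _) (hρ0 t ht).le
  have ext_ws : ∀ p, WeaklySingular a (‖p‖ * Real.exp (μ * T)) T (ext p) := fun p =>
    ⟨ext_cont p, fun t ht => (ext_bd p t ht).trans (by
      rw [mul_assoc]; exact mul_le_mul_of_nonneg_left (hρle t ht) (norm_nonneg _))⟩
  have conv_ws := fun p => hk.weaklySingular (ext_ws p) hK ha ha
  -- the weighted fixed-point map
  let Φ : (BoundedContinuousFunction (Ioc (0 : ℝ) T) H) →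
      BoundedContinuousFunction (Ioc (0 : ℝ) T) H := fun p =>
    BoundedContinuousFunction.ofNormedAddCommGroup
      (fun t : Ioc (0 : ℝ) T => (ρ t)⁻¹ • (h t + ∫ s in (0 : ℝ)..t, k (t - s) (ext p s)))
      (by
        have h1 : ContinuousOn (fun t => (ρ t)⁻¹ • (h t + ∫ s in (0 : ℝ)..t, k (t - s) (ext p s)))
            (Ioc 0 T) :=
          (hρc.inv₀ fun t ht => (hρ0 t ht).ne').smul (hh.continuousOn.add (conv_ws p).continuousOn)
        exact continuousOn_iff_continuous_domRestrict.1 h1)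
      (C + ‖p‖ / 2) (by
        rintro ⟨t, ht⟩
        rw [norm_smul, norm_inv, Real.norm_of_nonneg (hρ0 t ht).le,
          inv_mul_le_iff₀ (hρ0 t ht)]
        refine (norm_add_le _ _).trans ?_
        have h1 := hμk k hk ‖p‖ (ext p) (norm_nonneg _) (ext_bd p) t ht
        have h2 := (hh.bound t ht).trans (mul_le_mul_of_nonneg_left (hρge t ht) hC)
        change _ ≤ _ * ρ t at h1
        linarith)
  have Φ_apply : ∀ p (t : Ioc (0 : ℝ) T), Φ p t =
      (ρ t)⁻¹ • (h t + ∫ s in (0 : ℝ)..t, k (t - s) (ext p s)) := fun p t => rfl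
  have hcontr : ContractingWith (1 / 2) Φ := by
    refine ⟨by norm_num [← NNReal.coe_lt_coe], LipschitzWith.of_dist_le_mul fun p p' => ?_⟩
    rw [dist_eq_norm, dist_eq_norm]
    refine (BoundedContinuousFunction.norm_le (by positivity)).2 ?_
    rintro ⟨t, ht⟩
    rw [BoundedContinuousFunction.coe_sub, Pi.sub_apply, Φ_apply, Φ_apply, ← smul_sub,
      add_sub_add_left_eq_sub, ← intervalIntegral.integral_sub
        (hk.intervalIntegrable (ext_ws p) hK ha ha ht)
        (hk.intervalIntegrable (ext_ws p') hK ha ha ht), norm_smul, norm_inv,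
      Real.norm_of_nonneg (hρ0 t ht).le, inv_mul_le_iff₀ (hρ0 t ht)]
    simp only [← hlin]
    have := hμk k hk ‖p - p'‖ (fun s => ext p s - ext p' s) (norm_nonneg _) (fun s hs => by
      have h1 := ext_bd (p - p') s hs
      rwa [ext_of _ ⟨s, hs⟩, BoundedContinuousFunction.coe_sub, Pi.sub_apply, smul_sub,
        ← ext_of p ⟨s, hs⟩, ← ext_of p' ⟨s, hs⟩] at h1) t ht
    refine this.trans (le_of_eq ?_)
    simp only [hρ]
    push_cast
    ring
  set p := hcontr.fixedPoint with hp
  have hfix : Φ p = p := hcontr.fixedPoint_isFixedPt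
  have hsol : ∀ t ∈ Ioc 0 T, ext p t = h t + ∫ s in (0 : ℝ)..t, k (t - s) (ext p s) := by
    intro t ht
    have h1 := Φ_apply p ⟨t, ht⟩
    rw [hfix] at h1
    rw [ext_of p ⟨t, ht⟩, h1, smul_smul, mul_inv_cancel₀ (hρ0 t ht).ne', one_smul]
  have hnorm : ‖p‖ ≤ 2 * C := by
    have : ‖Φ p‖ ≤ C + ‖p‖ / 2 :=
      BoundedContinuousFunction.norm_ofNormedAddCommGroup_le _ (by positivity) _
    rw [hfix] at this
    linarith
  refine ⟨ext p, ⟨ext_cont p, fun t ht => ((ext_ws p).bound t ht).trans ?_⟩, hsol⟩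
  have h0 := Real.rpow_nonneg ht.1.le (a - 1)
  calc _ ≤ 2 * C * Real.exp (μ * T) * t ^ (a - 1) := by gcongr
    _ = _ := by ring

end Volterra

end WeaklySingular

/-! ### Scalar convolutions on `[0,t]` -/

section ScalarConvolution

open MeasureTheory Filter Topology

variable {𝕜 : Type*} [RCLike 𝕜]

/-- The convolution `∫₀ᵗ f(t-s) g(s) ds` of scalar functions on the half-line. -/
noncomputable def halfConv (f g : ℝ → 𝕜) (t : ℝ) : 𝕜 := ∫ s in (0 : ℝ)..t, f (t - s) * g s

theorem halfConv_comm (f g : ℝ → 𝕜) (t : ℝ) : halfConv f g t = halfConv g f t := by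
  have h := intervalIntegral.integral_comp_sub_left (a := 0) (b := t)
    (fun s => g (t - s) * f s) t
  simp only [sub_sub_cancel, sub_zero, sub_self] at h
  rw [halfConv, halfConv, ← h]
  simp only [mul_comm]

theorem halfConv_one (f : ℝ → 𝕜) (t : ℝ) :
    halfConv (fun _ => 1) f t = ∫ s in (0 : ℝ)..t, f s := by
  simp [halfConv]

theorem halfConv_congr_right {f g g' : ℝ → 𝕜} {t : ℝ} (ht : 0 ≤ t)
    (h : ∀ s ∈ Ioc 0 t, g s = g' s) : halfConv f g t = halfConv f g' t := by
  refine intervalIntegral.integral_congr_ae (Eventually.of_forall fun s hs => ?_)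
  rw [uIoc_of_le ht] at hs
  simp only [h s hs]

/-- Up to time `T`, the convolution over the line of functions that vanish for negative times is
the convolution over the half-line. -/
theorem convolution_eq_indicator_halfConv {F G f g : ℝ → 𝕜} {T : ℝ} (hT : 0 ≤ T)
    (hF : ∀ u ≤ T, F u = (Ioi 0).indicator f u) (hG : ∀ u ≤ T, G u = (Ioi 0).indicator g u) :
    ∀ u ≤ T, (convolution F G (ContinuousLinearMap.mul ℝ 𝕜) volume) u =
      (Ioi 0).indicator (halfConv f g) u := by
  intro u hu
  have h1 : ∀ s, F (u - s) * G s = (Ioo 0 u).indicator (fun s => f (u - s) * g s) s := by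
    intro s
    by_cases hs0 : 0 < s
    · rw [hF _ (by linarith)]
      by_cases hsu : s < u
      · rw [hG s (hsu.le.trans hu), indicator_of_mem (show u - s ∈ Ioi 0 from sub_pos.2 hsu),
          indicator_of_mem (show s ∈ Ioi 0 from hs0), indicator_of_mem (show s ∈ Ioo 0 u from ⟨hs0, hsu⟩)]
      · rw [indicator_of_notMem (s := Ioi (0 : ℝ)) (fun h => hsu (sub_pos.1 h)),
          indicator_of_notMem (fun h => hsu h.2), zero_mul]
    · rw [indicator_of_notMem (fun h => hs0 h.1)]
      rw [hG s (by linarith), indicator_of_notMem (s := Ioi (0 : ℝ)) hs0, mul_zero]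
  have h2 : (convolution F G (ContinuousLinearMap.mul ℝ 𝕜) volume) u = ∫ s, F (u - s) * G s :=
    convolution_eq_swap _
  rw [h2]
  simp only [h1]
  rw [integral_indicator measurableSet_Ioo]
  by_cases h0 : 0 < u
  · rw [indicator_of_mem (show u ∈ Ioi 0 from h0), halfConv,
      intervalIntegral.integral_of_le h0.le, integral_Ioc_eq_integral_Ioo]
  · rw [indicator_of_notMem (s := Ioi (0 : ℝ)) h0, Ioo_eq_empty h0]
    simp

/-- Continuity of the first factor makes the threefold convolution exist at every `t`, not only
almost everywhere. -/
theorem halfConv_assoc {f g k : ℝ → 𝕜} {t : ℝ} (ht : 0 < t) (hf : ContinuousOn f (Icc 0 t))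
    (hg : IntervalIntegrable g volume 0 t) (hk : IntervalIntegrable k volume 0 t) :
    halfConv f (halfConv g k) t = halfConv (halfConv f g) k t := by
  set F := (Ioc 0 t).indicator f with hF
  set G := (Ioc 0 t).indicator g with hG
  set K := (Ioc 0 t).indicator k with hK
  have hind : ∀ p : ℝ → 𝕜, ∀ u ≤ t, (Ioc 0 t).indicator p u = (Ioi 0).indicator p u := by
    intro p u hu
    by_cases h0 : 0 < u
    · rw [indicator_of_mem (show u ∈ Ioi 0 from h0), indicator_of_mem (show u ∈ Ioc 0 t from ⟨h0, hu⟩)]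
    · rw [indicator_of_notMem (s := Ioi (0 : ℝ)) h0, indicator_of_notMem fun h => h0 h.1]
  have hFi : Integrable F := by
    rw [hF, integrable_indicator_iff measurableSet_Ioc]
    exact (hf.integrableOn_Icc).mono_set Ioc_subset_Icc_self
  have hGi : Integrable G := by
    rw [hG, integrable_indicator_iff measurableSet_Ioc]
    exact (intervalIntegrable_iff_integrableOn_Ioc_of_le ht.le).1 hg
  have hKi : Integrable K := by
    rw [hK, integrable_indicator_iff measurableSet_Ioc]
    exact (intervalIntegrable_iff_integrableOn_Ioc_of_le ht.le).1 hk
  obtain ⟨C, hC⟩ := isCompact_Icc.exists_bound_of_continuousOn hf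
  have hFb : ∀ u, ‖F u‖ ≤ max C 0 := fun u => by
    rw [hF, indicator]
    split_ifs with h
    · exact (hC u (Ioc_subset_Icc_self h)).trans (le_max_left _ _)
    · simp
  have hassoc := convolution_assoc (μ := volume) (ν := volume) (f := F) (g := G) (k := K)
    (ContinuousLinearMap.mul ℝ 𝕜)
    (ContinuousLinearMap.mul ℝ 𝕜) (ContinuousLinearMap.mul ℝ 𝕜) (ContinuousLinearMap.mul ℝ 𝕜)
    (fun x y z => by simp [mul_assoc]) (x₀ := t) hFi.aestronglyMeasurable
    hGi.aestronglyMeasurable hKi.aestronglyMeasurable (hFi.ae_convolution_exists _ hGi)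
    (hGi.norm.ae_convolution_exists _ hKi.norm)
    (by
      have h1 := hGi.norm.integrable_convolution (ContinuousLinearMap.mul ℝ ℝ) hKi.norm
      exact (h1.comp_sub_left t).bdd_mul (c := max C 0) hFi.norm.aestronglyMeasurable
        (Eventually.of_forall fun u => by simpa using hFb u))
  have h0 : t ∈ Ioi (0 : ℝ) := ht
  rw [convolution_eq_indicator_halfConv ht.le (convolution_eq_indicator_halfConv ht.le (hind f) (hind g))
      (hind k) t le_rfl,
    convolution_eq_indicator_halfConv ht.le (hind f) (convolution_eq_indicator_halfConv ht.le (hind g)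
      (hind k)) t le_rfl, indicator_of_mem h0, indicator_of_mem h0] at hassoc
  exact hassoc.symm

theorem integral_halfConv {f g : ℝ → 𝕜} {t : ℝ} (ht : 0 < t)
    (hf : IntervalIntegrable f volume 0 t) (hg : IntervalIntegrable g volume 0 t) :
    ∫ s in (0 : ℝ)..t, halfConv f g s = halfConv (fun r => ∫ s in (0 : ℝ)..r, f s) g t := by
  rw [← halfConv_one, halfConv_assoc ht continuousOn_const hf hg]
  simp only [funext (halfConv_one f)]

theorem integral_halfConv' {f g : ℝ → 𝕜} {t : ℝ} (ht : 0 < t)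
    (hf : IntervalIntegrable f volume 0 t) (hg : IntervalIntegrable g volume 0 t) :
    ∫ s in (0 : ℝ)..t, halfConv f g s = halfConv f (fun r => ∫ s in (0 : ℝ)..r, g s) t := by
  rw [halfConv_comm f, ← integral_halfConv ht hg hf]
  simp only [halfConv_comm f]

/-- The scalar exponential `e^{-lt}`, as an element of `𝕜`. -/
noncomputable def expNeg (𝕜 : Type*) [RCLike 𝕜] (l t : ℝ) : 𝕜 := ((Real.exp (-(l * t)) : ℝ) : 𝕜)

theorem continuous_expNeg (l : ℝ) : Continuous (expNeg 𝕜 l) :=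
  RCLike.continuous_ofReal.comp (by fun_prop)

theorem mul_integral_expNeg_real {l : ℝ} (t : ℝ) :
    l * ∫ s in (0 : ℝ)..t, Real.exp (-(l * s)) = 1 - Real.exp (-(l * t)) := by
  have h : ∀ s : ℝ, HasDerivAt (fun s => -Real.exp (-(l * s))) (l * Real.exp (-(l * s))) s := by
    intro s
    have := (((hasDerivAt_id s).const_mul l).neg.exp).neg
    convert! this using 1
    simp; ring
  rw [← intervalIntegral.integral_const_mul, intervalIntegral.integral_eq_sub_of_hasDerivAt
    (fun s _ => h s) (Continuous.intervalIntegrable (by fun_prop) _ _)]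
  simp; ring

theorem mul_integral_expNeg (l t : ℝ) :
    (l : 𝕜) * ∫ s in (0 : ℝ)..t, expNeg 𝕜 l s = 1 - expNeg 𝕜 l t := by
  have h : ∫ s in (0 : ℝ)..t, expNeg 𝕜 l s = ((∫ s in (0 : ℝ)..t, Real.exp (-(l * s)) : ℝ) : 𝕜) :=
    RCLike.intervalIntegral_ofReal
  rw [h, ← RCLike.ofReal_mul, mul_integral_expNeg_real, expNeg]
  simp

theorem integral_expNeg_sub {l t δ : ℝ} :
    ∫ s in δ..t, (l : 𝕜) * expNeg 𝕜 l s = expNeg 𝕜 l δ - expNeg 𝕜 l t := by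
  have hi : ∀ a b : ℝ, IntervalIntegrable (expNeg 𝕜 l) volume a b :=
    fun a b => (continuous_expNeg l).intervalIntegrable a b
  rw [intervalIntegral.integral_const_mul,
    ← intervalIntegral.integral_add_adjacent_intervals (hi δ 0) (hi 0 t), mul_add,
    mul_integral_expNeg, intervalIntegral.integral_symm, mul_neg, mul_integral_expNeg]
  ring

/-- The variation of constants formula gives a solution of the integrated equation
`y = c + ∫ (χ - l y)`. -/
theorem eq_add_integral_of_duhamel {l t : ℝ} (ht : 0 < t) {c : 𝕜} {χ y : ℝ → 𝕜}
    (hχ : IntervalIntegrable χ volume 0 t) (hyi : IntervalIntegrable y volume 0 t)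
    (hy : ∀ s ∈ Ioc 0 t, y s = expNeg 𝕜 l s * c + halfConv (expNeg 𝕜 l) χ s) :
    y t = c + ∫ s in (0 : ℝ)..t, (χ s - l * y s) := by
  have hε := continuous_expNeg (𝕜 := 𝕜) l
  have hεi : IntervalIntegrable (expNeg 𝕜 l) volume 0 t := hε.intervalIntegrable _ _
  have hci : IntervalIntegrable (fun s => expNeg 𝕜 l s * c) volume 0 t := hεi.mul_const c
  have hconvi : IntervalIntegrable (halfConv (expNeg 𝕜 l) χ) volume 0 t := by
    refine (hyi.sub hci).congr fun s hs => ?_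
    rw [uIoc_of_le ht.le] at hs
    simp [hy s hs]
  have h1 : ∫ s in (0 : ℝ)..t, y s = (∫ s in (0 : ℝ)..t, expNeg 𝕜 l s) * c +
      ∫ s in (0 : ℝ)..t, halfConv (expNeg 𝕜 l) χ s := by
    rw [← intervalIntegral.integral_mul_const, ← intervalIntegral.integral_add hci hconvi]
    refine intervalIntegral.integral_congr_ae (Eventually.of_forall fun s hs => ?_)
    rw [uIoc_of_le ht.le] at hs
    exact hy s hs
  have h2 : (l : 𝕜) * ∫ s in (0 : ℝ)..t, halfConv (expNeg 𝕜 l) χ s =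
      (∫ s in (0 : ℝ)..t, χ s) - halfConv (expNeg 𝕜 l) χ t := by
    rw [integral_halfConv ht hεi hχ, halfConv, halfConv, ← intervalIntegral.integral_const_mul,
      ← intervalIntegral.integral_sub hχ (hχ.continuousOn_mul (by fun_prop))]
    refine intervalIntegral.integral_congr fun s _ => ?_
    rw [← mul_assoc, mul_integral_expNeg]
    ring
  rw [intervalIntegral.integral_sub hχ (hyi.const_mul _), intervalIntegral.integral_const_mul,
    h1, mul_add, h2, ← mul_assoc, mul_integral_expNeg, hy t ⟨ht, le_rfl⟩]
  ring

/-- The variation of constants formula for `ξ' = -l ξ + χ`, `ξ(0) = 0`. -/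
theorem duhamel_of_hasDerivWithinAt {l T t : ℝ} (ht : t ∈ Ioc 0 T) {ξ χ : ℝ → 𝕜}
    (hξ : ContinuousOn ξ (Icc 0 T)) (h0 : ξ 0 = 0) (hχ : IntervalIntegrable χ volume 0 t)
    (hd : ∀ s ∈ Ioc 0 T, HasDerivWithinAt ξ (χ s - l * ξ s) (Ioc 0 T) s) :
    ξ t = halfConv (expNeg 𝕜 l) χ t := by
  have h1 : ∀ s ∈ Ioo 0 t, HasDerivAt (fun s => Real.exp (l * s) • ξ s)
      (Real.exp (l * s) • χ s) s := by
    intro s hs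
    have h2 : HasDerivAt ξ (χ s - l * ξ s) s :=
      (hd s ⟨hs.1, hs.2.le.trans ht.2⟩).hasDerivAt
        (Filter.mem_of_superset (Ioo_mem_nhds hs.1 (hs.2.trans_le ht.2)) Ioo_subset_Ioc_self)
    have h3 := ((hasDerivAt_id s).const_mul l).exp.smul h2
    convert! h3 using 1
    simp only [id, mul_one, RCLike.real_smul_eq_coe_mul]
    push_cast
    ring
  have h4 := intervalIntegral.integral_eq_sub_of_hasDerivAt_of_le ht.1.le
    (f := fun s => Real.exp (l * s) • ξ s)
    (ContinuousOn.smul (by fun_prop) (hξ.mono (Icc_subset_Icc_right ht.2))) h1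
    (hχ.continuousOn_smul (by fun_prop))
  rw [h0, smul_zero, sub_zero] at h4
  have h5 : ξ t = Real.exp (-(l * t)) • Real.exp (l * t) • ξ t := by
    rw [smul_smul, ← Real.exp_add, neg_add_cancel, Real.exp_zero, one_smul]
  rw [h5, ← h4, ← intervalIntegral.integral_smul, halfConv]
  refine intervalIntegral.integral_congr fun s _ => ?_
  simp only [expNeg]
  rw [smul_smul, ← Real.exp_add, RCLike.real_smul_eq_coe_mul]
  ring_nf

/-- The fundamental theorem of calculus on `(0,T]` for weakly singular functions. -/
theorem WeaklySingular.hasDerivWithinAt_integral {F : Type*} [NormedAddCommGroup F]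
    [NormedSpace ℝ F] [CompleteSpace F] {a C T : ℝ} {z x : ℝ → F} {c : F}
    (hz : WeaklySingular a C T z) (ha : 0 < a)
    (hx : ∀ t ∈ Ioc 0 T, x t = c + ∫ s in (0 : ℝ)..t, z s) {t : ℝ} (ht : t ∈ Ioc 0 T) :
    HasDerivWithinAt x (z t) (Ioc 0 T) t := by
  -- continue `z` by a constant beyond `T`
  have hmin : ∀ s ∈ Ioc 0 T, min s T = s := fun s hs => min_eq_left hs.2
  have hcont : ContinuousOn (fun s => z (min s T)) (Ioi 0) :=
    hz.continuousOn.comp (by fun_prop) fun s hs =>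
      ⟨lt_min hs (ht.1.trans_le ht.2), min_le_right _ _⟩
  have hcongr : ∀ s ∈ Ioc 0 T, ∫ r in (0 : ℝ)..s, z r = ∫ r in (0 : ℝ)..s, z (min r T) := by
    intro s hs
    refine intervalIntegral.integral_congr_ae (Eventually.of_forall fun r hr => ?_)
    rw [uIoc_of_le hs.1.le] at hr
    rw [hmin r ⟨hr.1, hr.2.trans hs.2⟩]
  have hint : IntervalIntegrable (fun s => z (min s T)) volume 0 t :=
    (hz.intervalIntegrable ha ⟨ht.1.le, ht.2⟩).congr fun r hr => by
      rw [uIoc_of_le ht.1.le] at hr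
      simp only [hmin r ⟨hr.1, hr.2.trans ht.2⟩]
  have h := intervalIntegral.integral_hasDerivAt_right hint
    (hcont.stronglyMeasurableAtFilter isOpen_Ioi t ht.1) (hcont.continuousAt (Ioi_mem_nhds ht.1))
  rw [hmin t ht] at h
  refine ((h.const_add c).hasDerivWithinAt (s := Ioc 0 T)).congr_of_mem (fun s hs => ?_) ht
  rw [hx s hs, hcongr s hs]

/-! ### The Abel kernel and its smoothing by the semigroup -/

/-- The multiplier `∫₀ᵗ l e^{-l(t-s)} s^{α-1} / Γ(α) ds` of the convolution of `A exp(-tA)` with the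
Abel kernel. -/
noncomputable def abelMultiplier (α t l : ℝ) : ℝ :=
  ∫ s in (0 : ℝ)..t, l * Real.exp (-(l * (t - s))) * (s ^ (α - 1) / Real.Gamma α)

theorem mul_exp_neg_le {l r : ℝ} (hr : 0 < r) : l * Real.exp (-(l * r)) ≤ 1 / r := by
  rw [le_div_iff₀ hr, Real.exp_neg, mul_right_comm, ← div_eq_mul_inv, div_le_one (Real.exp_pos _)]
  linarith [Real.add_one_le_exp (l * r)]

/-- The bound does not depend on `l`: the factor `l e^{-l(t-s)}` is at most `2/t` on the first half
of the interval, and has integral at most `1` on the second half, where `s^{α-1}` is bounded. -/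
theorem abs_abelMultiplier_le {α t l : ℝ} (hα : α ∈ Ioo (0 : ℝ) 1) (ht : 0 < t) (hl : 0 < l) :
    |abelMultiplier α t l| ≤ (2 / α + 2 ^ (1 - α)) / Real.Gamma α * t ^ (α - 1) := by
  have hΓ := Real.Gamma_pos_of_pos hα.1
  have h0 : 0 ≤ abelMultiplier α t l := by
    refine intervalIntegral.integral_nonneg ht.le fun s hs => ?_
    have := Real.rpow_nonneg hs.1 (α - 1)
    positivity
  rw [abs_of_nonneg h0]
  have hpt : ∀ s ∈ Ioo 0 t, ‖l * Real.exp (-(l * (t - s))) * (s ^ (α - 1) / Real.Gamma α)‖ ≤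
      (2 / t * s ^ (α - 1) + (t / 2) ^ (α - 1) * (l * Real.exp (-(l * (t - s))))) /
        Real.Gamma α := by
    intro s hs
    have hs0 := Real.rpow_nonneg hs.1.le (α - 1)
    have ht0 : 0 ≤ (t / 2) ^ (α - 1) := Real.rpow_nonneg (by linarith) (α - 1)
    have h1 := mul_exp_neg_le (l := l) (sub_pos.2 hs.2)
    have h2 : 0 ≤ l * Real.exp (-(l * (t - s))) := by positivity
    rw [Real.norm_of_nonneg (by positivity), ← mul_div_assoc]
    gcongr
    have htt : 0 ≤ 2 / t := by positivity
    rcases le_total s (t / 2) with h | h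
    · have h3 : 1 / (t - s) ≤ 2 / t := by
        rw [div_le_div_iff₀ (sub_pos.2 hs.2) ht]; linarith
      have := mul_le_mul_of_nonneg_right (h1.trans h3) hs0
      have := mul_nonneg ht0 h2
      linarith
    · have h3 : s ^ (α - 1) ≤ (t / 2) ^ (α - 1) :=
        Real.rpow_le_rpow_of_nonpos (by linarith) h (by linarith [hα.2])
      have := mul_le_mul_of_nonneg_left h3 h2
      have := mul_nonneg htt hs0
      linarith
  have hi1 : IntervalIntegrable (fun s : ℝ => s ^ (α - 1)) volume 0 t :=
    intervalIntegral.intervalIntegrable_rpow' (by linarith [hα.1])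
  have hi2 : IntervalIntegrable (fun s : ℝ => l * Real.exp (-(l * (t - s)))) volume 0 t :=
    Continuous.intervalIntegrable (by fun_prop) _ _
  have hE : ∫ s in (0 : ℝ)..t, l * Real.exp (-(l * (t - s))) ≤ 1 := by
    have := intervalIntegral.integral_comp_sub_left (a := 0) (b := t)
      (fun s => l * Real.exp (-(l * s))) t
    rw [this, sub_self, sub_zero, intervalIntegral.integral_const_mul, mul_integral_expNeg_real]
    linarith [Real.exp_pos (-(l * t))]
  have hP : ∫ s in (0 : ℝ)..t, s ^ (α - 1) = t ^ α / α := by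
    rw [integral_rpow (Or.inl (by linarith [hα.1])), sub_add_cancel, Real.zero_rpow hα.1.ne',
      sub_zero]
  have h3 : abelMultiplier α t l ≤ _ := (Real.le_norm_self _).trans
    (norm_intervalIntegral_le_of_Ioo ht.le
      (((hi1.const_mul (2 / t)).add (hi2.const_mul ((t / 2) ^ (α - 1)))).div_const _) hpt)
  refine h3.trans ?_
  rw [intervalIntegral.integral_div, intervalIntegral.integral_add (hi1.const_mul _)
    (hi2.const_mul _), intervalIntegral.integral_const_mul, intervalIntegral.integral_const_mul, hP,
    div_mul_eq_mul_div _ (Real.Gamma α)]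
  refine div_le_div_of_nonneg_right ?_ hΓ.le
  have h4 : (t / 2) ^ (α - 1) = 2 ^ (1 - α) * t ^ (α - 1) := by
    rw [Real.div_rpow ht.le (by norm_num), show α - 1 = -(1 - α) by ring,
      Real.rpow_neg (x := 2) (by norm_num)]
    field_simp
  have h5 : t ^ α = t * t ^ (α - 1) := by
    conv_lhs => rw [show α = 1 + (α - 1) by ring, Real.rpow_add ht, Real.rpow_one]
  have h6 : 0 ≤ (t / 2) ^ (α - 1) := Real.rpow_nonneg (by linarith) _
  calc _ ≤ 2 / t * (t ^ α / α) + (t / 2) ^ (α - 1) * 1 := by gcongr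
    _ = _ := by
      rw [h4, h5]
      have := hα.1.ne'
      field_simp

theorem continuousOn_abelMultiplier {α T : ℝ} (hα : 0 < α) {l : ℝ} (hl : 0 < l) :
    ContinuousOn (fun t => abelMultiplier α t l) (Ioc 0 T) := by
  have hN : WeaklySingularKernel 1 l T fun r (x : ℝ) => l * Real.exp (-(l * r)) * x := by
    refine ⟨by fun_prop, fun r hr x => ?_⟩
    rw [norm_mul, sub_self, Real.rpow_zero, Real.norm_of_nonneg (by positivity)]
    refine mul_le_mul_of_nonneg_right (mul_le_mul_of_nonneg_left ?_ hl.le) (norm_nonneg _)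
    refine (Real.exp_le_one_iff.2 ?_)
    have := mul_pos hl hr.1
    linarith
  have hx : WeaklySingular α (1 / Real.Gamma α) T fun s : ℝ => s ^ (α - 1) / Real.Gamma α := by
    refine ⟨(ContinuousOn.rpow_const (by fun_prop) fun t ht => Or.inl ht.1.ne').div_const _,
      fun t ht => le_of_eq ?_⟩
    have hΓ := Real.Gamma_pos_of_pos hα
    have := Real.rpow_nonneg ht.1.le (α - 1)
    rw [Real.norm_of_nonneg (by positivity)]
    ring
  exact (hN.weaklySingular hx hl.le hα one_pos).continuousOn

/-- The Abel kernel `t^{α-1} / Γ(α)` with values in `𝕜`. -/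
noncomputable def abelKernel (𝕜 : Type*) [RCLike 𝕜] (α t : ℝ) : 𝕜 :=
  ((t ^ (α - 1) / Real.Gamma α : ℝ) : 𝕜)

theorem weaklySingular_abelKernel {α T : ℝ} (hα : 0 < α) :
    WeaklySingular α (1 / Real.Gamma α) T (abelKernel 𝕜 α) := by
  refine ⟨RCLike.continuous_ofReal.comp_continuousOn
    ((ContinuousOn.rpow_const (by fun_prop) fun t ht => Or.inl ht.1.ne').div_const _),
    fun t ht => le_of_eq ?_⟩
  have hΓ := Real.Gamma_pos_of_pos hα
  have := Real.rpow_nonneg ht.1.le (α - 1)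
  rw [abelKernel, RCLike.norm_ofReal, abs_of_nonneg (by positivity)]
  ring

theorem intervalIntegrable_abelKernel {α t : ℝ} (hα : 0 < α) (ht : 0 ≤ t) :
    IntervalIntegrable (abelKernel 𝕜 α) volume 0 t :=
  (weaklySingular_abelKernel (T := t) hα).intervalIntegrable hα ⟨ht, le_rfl⟩

theorem ofReal_abelMultiplier (α t l : ℝ) : ((abelMultiplier α t l : ℝ) : 𝕜) =
    (l : 𝕜) * halfConv (expNeg 𝕜 l) (abelKernel 𝕜 α) t := by
  rw [abelMultiplier, ← RCLike.intervalIntegral_ofReal, halfConv,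
    ← intervalIntegral.integral_const_mul]
  refine intervalIntegral.integral_congr fun s _ => ?_
  simp only [expNeg, abelKernel]
  push_cast
  ring

theorem halfConv_abelMultiplier {α t l : ℝ} (hα : 0 < α) (ht : 0 < t) {ρ : ℝ → 𝕜}
    (hρ : IntervalIntegrable ρ volume 0 t) :
    halfConv (fun r => ((abelMultiplier α r l : ℝ) : 𝕜)) ρ t =
      (l : 𝕜) * halfConv (expNeg 𝕜 l) (halfConv (abelKernel 𝕜 α) ρ) t := by
  rw [halfConv_assoc ht (continuous_expNeg l).continuousOn
    (intervalIntegrable_abelKernel hα ht.le) hρ]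
  simp only [halfConv, ← intervalIntegral.integral_const_mul, ofReal_abelMultiplier]
  simp only [intervalIntegral.integral_const_mul, mul_assoc]

end ScalarConvolution

/-! ### Operator kernels -/

section Kernels

open MeasureTheory Filter Topology

section General

variable {E F G : Type*} [NormedAddCommGroup E] [NormedAddCommGroup F] [NormedAddCommGroup G]
  {a b K T : ℝ}

theorem WeaklySingularKernel.mono {N : ℝ → E → F} {K' b' : ℝ} (hN : WeaklySingularKernel b K T N)
    (hb : b' ≤ b) (hK : 0 ≤ K) (hK' : K * T ^ (b - b') ≤ K') :
    WeaklySingularKernel b' K' T N := by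
  refine ⟨hN.continuousOn, fun r hr x => (hN.bound r hr x).trans ?_⟩
  refine mul_le_mul_of_nonneg_right ?_ (norm_nonneg x)
  rw [show b - 1 = (b - b') + (b' - 1) by ring, Real.rpow_add hr.1, ← mul_assoc]
  have : r ^ (b - b') ≤ T ^ (b - b') := Real.rpow_le_rpow hr.1.le hr.2 (by linarith)
  have h2 : 0 ≤ r ^ (b' - 1) := Real.rpow_nonneg hr.1.le _
  exact mul_le_mul_of_nonneg_right ((mul_le_mul_of_nonneg_left this hK).trans hK') h2

theorem WeaklySingularKernel.sub {N N' : ℝ → E → F} {K' : ℝ} (hN : WeaklySingularKernel b K T N)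
    (hN' : WeaklySingularKernel b K' T N') :
    WeaklySingularKernel b (K + K') T fun r x => N r x - N' r x := by
  refine ⟨hN.continuousOn.sub hN'.continuousOn, fun r hr x => ?_⟩
  rw [add_mul, add_mul]
  exact (norm_sub_le _ _).trans (add_le_add (hN.bound r hr x) (hN'.bound r hr x))

theorem WeaklySingularKernel.sum {ι : Type*} {s : Finset ι} {N : ι → ℝ → E → F} {K : ι → ℝ}
    (hN : ∀ i ∈ s, WeaklySingularKernel b (K i) T (N i)) :
    WeaklySingularKernel b (∑ i ∈ s, K i) T fun r x => ∑ i ∈ s, N i r x := by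
  refine ⟨continuousOn_finsetSum _ fun i hi => (hN i hi).continuousOn, fun r hr x => ?_⟩
  rw [Finset.sum_mul, Finset.sum_mul]
  exact norm_sum_le_of_le _ fun i hi => (hN i hi).bound r hr x

theorem WeaklySingular.mul_kernel {𝕜 : Type*} [RCLike 𝕜] {f : ℝ → 𝕜}
    (hf : WeaklySingular b K T f) : WeaklySingularKernel b K T fun r (x : 𝕜) => f r * x := by
  refine ⟨(hf.continuousOn.comp continuousOn_fst fun p hp => hp.1).mul continuousOn_snd,
    fun r hr x => ?_⟩
  rw [norm_mul]
  exact mul_le_mul_of_nonneg_right (hf.bound r hr) (norm_nonneg _)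

theorem WeaklySingular.smul_kernel {𝕜 : Type*} [RCLike 𝕜] [NormedSpace 𝕜 F] {f : ℝ → 𝕜}
    (hf : WeaklySingular b K T f) : WeaklySingularKernel b K T fun r (x : F) => f r • x := by
  refine ⟨(hf.continuousOn.comp continuousOn_fst fun p hp => hp.1).smul continuousOn_snd,
    fun r hr x => ?_⟩
  rw [norm_smul]
  exact mul_le_mul_of_nonneg_right (hf.bound r hr) (norm_nonneg _)

theorem WeaklySingularKernel.comp_clm {𝕜 : Type*} [RCLike 𝕜] [NormedSpace 𝕜 E] [NormedSpace 𝕜 F]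
    {N : ℝ → F → G} (hN : WeaklySingularKernel b K T N) (hK : 0 ≤ K) (S : E →L[𝕜] F) :
    WeaklySingularKernel b (K * ‖S‖) T fun r x => N r (S x) := by
  refine ⟨hN.continuousOn.comp (f := fun p : ℝ × E => (p.1, S p.2)) (by fun_prop)
    fun p hp => ⟨hp.1, mem_univ _⟩, fun r hr x => (hN.bound r hr _).trans ?_⟩
  have h0 := Real.rpow_nonneg hr.1.le (b - 1)
  calc _ ≤ K * r ^ (b - 1) * (‖S‖ * ‖x‖) := by gcongr; exact S.le_opNorm x
    _ = _ := by ring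

theorem WeaklySingularKernel.apply {N : ℝ → E → F} (hN : WeaklySingularKernel b K T N) (x : E) :
    WeaklySingular b (K * ‖x‖) T fun r => N r x :=
  ⟨hN.continuousOn.comp (f := fun r => (r, x)) (by fun_prop) fun r hr => ⟨hr, mem_univ _⟩,
    fun r hr => (hN.bound r hr x).trans (le_of_eq (by ring))⟩

theorem WeaklySingular.clm {𝕜 : Type*} [RCLike 𝕜] [NormedSpace 𝕜 E] [NormedSpace 𝕜 F]
    {C : ℝ} {x : ℝ → E} (hx : WeaklySingular a C T x) (S : E →L[𝕜] F) :
    WeaklySingular a (‖S‖ * C) T fun t => S (x t) :=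
  ⟨S.continuous.comp_continuousOn hx.continuousOn, fun t ht => (S.le_opNorm _).trans
    (by rw [mul_assoc]; exact mul_le_mul_of_nonneg_left (hx.bound t ht) (norm_nonneg _))⟩

theorem WeaklySingular.add {C C' : ℝ} {x y : ℝ → E} (hx : WeaklySingular a C T x)
    (hy : WeaklySingular a C' T y) : WeaklySingular a (C + C') T fun t => x t + y t :=
  ⟨hx.continuousOn.add hy.continuousOn, fun t ht => by
    rw [add_mul]; exact (norm_add_le _ _).trans (add_le_add (hx.bound t ht) (hy.bound t ht))⟩

theorem WeaklySingular.sub {C C' : ℝ} {x y : ℝ → E} (hx : WeaklySingular a C T x)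
    (hy : WeaklySingular a C' T y) : WeaklySingular a (C + C') T fun t => x t - y t :=
  ⟨hx.continuousOn.sub hy.continuousOn, fun t ht => by
    rw [add_mul]; exact (norm_sub_le _ _).trans (add_le_add (hx.bound t ht) (hy.bound t ht))⟩

theorem WeaklySingular.neg {C : ℝ} {x : ℝ → E} (hx : WeaklySingular a C T x) :
    WeaklySingular a C T fun t => - x t :=
  ⟨hx.continuousOn.neg, fun t ht => by rw [norm_neg]; exact hx.bound t ht⟩

theorem WeaklySingular.sum {ι : Type*} {s : Finset ι} {C : ι → ℝ} {x : ι → ℝ → E}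
    (hx : ∀ i ∈ s, WeaklySingular a (C i) T (x i)) :
    WeaklySingular a (∑ i ∈ s, C i) T fun t => ∑ i ∈ s, x i t :=
  ⟨continuousOn_finsetSum _ fun i hi => (hx i hi).continuousOn, fun t ht => by
    rw [Finset.sum_mul]; exact norm_sum_le_of_le _ fun i hi => (hx i hi).bound t ht⟩

end General

variable {𝕜 H : Type*} [RCLike 𝕜] [NormedAddCommGroup H] [InnerProductSpace 𝕜 H] [CompleteSpace H]
  {A : H →ₗ.[𝕜] H} (hA : IsPosDefWithCompactInverse A)

include hA

/-- A family of multipliers that is continuous in time and bounded by `K t^{b-1}`, uniformly on the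
spectrum, is a weakly singular operator kernel. -/
theorem IsPosDefWithCompactInverse.weaklySingularKernel_funCalc {φ : ℝ → ℝ → ℝ} {b K T : ℝ}
    (hφ : ∀ t ∈ Ioc 0 T, ∀ l, 0 < l → |φ t l| ≤ K * t ^ (b - 1))
    (hc : ∀ l, 0 < l → ContinuousOn (fun t => φ t l) (Ioc 0 T)) :
    WeaklySingularKernel b K T fun r (x : H) => funCalc A (φ r) x := by
  refine ⟨?_, fun r hr x =>
    ContinuousLinearMap.le_of_opNorm_le _ (hA.norm_funCalc_le (hφ r hr)) x⟩
  rintro ⟨t₀, x₀⟩ ⟨ht₀, -⟩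
  set B : ℝ → ℝ := fun t => K * t ^ (b - 1) with hB
  have hBc : ContinuousOn B (Ioc 0 T) :=
    continuousOn_const.mul (ContinuousOn.rpow_const (by fun_prop) fun t ht => Or.inl ht.1.ne')
  set s : Set ℝ := {t | t ∈ Ioc 0 T ∧ B t ≤ B t₀ + 1} with hs
  have hsub : s ∈ 𝓝[Ioc 0 T] t₀ := by
    filter_upwards [self_mem_nhdsWithin, (hBc t₀ ht₀).eventually (gt_mem_nhds (lt_add_one _))]
      with t h1 h2 using ⟨h1, h2.le⟩
  have hcont : ContinuousWithinAt (fun t => funCalc A (φ t) x₀) (Ioc 0 T) t₀ := by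
    have h1 := hA.continuousOn_funCalc_apply (s := s) (φ := φ) (C := B t₀ + 1)
      (fun t ht l hl => (hφ t ht.1 l hl).trans ht.2)
      (fun l hl => (hc l hl).mono fun t ht => ht.1) x₀
    exact (h1 t₀ (mem_of_mem_nhdsWithin ht₀ hsub)).mono_of_mem_nhdsWithin hsub
  have hfst : Tendsto (fun p : ℝ × H => p.1) (𝓝[Ioc 0 T ×ˢ univ] (t₀, x₀)) (𝓝[Ioc 0 T] t₀) :=
    continuousWithinAt_fst.tendsto_nhdsWithin fun p hp => hp.1
  have h2 : Tendsto (fun p : ℝ × H => funCalc A (φ p.1) (p.2 - x₀))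
      (𝓝[Ioc 0 T ×ˢ univ] (t₀, x₀)) (𝓝 0) := by
    refine squeeze_zero_norm' (a := fun p : ℝ × H => (B t₀ + 1) * ‖p.2 - x₀‖) ?_ ?_
    · filter_upwards [hfst hsub] with p hp
      exact (ContinuousLinearMap.le_of_opNorm_le _ (hA.norm_funCalc_le (hφ p.1 hp.1)) _).trans
        (mul_le_mul_of_nonneg_right hp.2 (norm_nonneg _))
    · have : Continuous fun p : ℝ × H => (B t₀ + 1) * ‖p.2 - x₀‖ := by fun_prop
      have := (this.tendsto (t₀, x₀)).mono_left (nhdsWithin_le_nhds (s := Ioc 0 T ×ˢ univ))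
      simpa using this
  have h3 := (hcont.tendsto.comp hfst).add h2
  rw [add_zero] at h3
  refine h3.congr fun p => ?_
  simp

/-- The semigroup `exp(-tA)`. -/
noncomputable def semigroup (A : H →ₗ.[𝕜] H) (t : ℝ) : H →L[𝕜] H :=
  funCalc A fun l => Real.exp (-(l * t))

/-- The operator `A exp(-tA)`. -/
noncomputable def opSemigroup (A : H →ₗ.[𝕜] H) (t : ℝ) : H →L[𝕜] H :=
  funCalc A fun l => l * Real.exp (-(l * t))

/-- The convolution of `A exp(-tA)` with the Abel kernel of order `α`. -/
noncomputable def abelOp (A : H →ₗ.[𝕜] H) (α t : ℝ) : H →L[𝕜] H :=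
  funCalc A (abelMultiplier α t)

namespace IsPosDefWithCompactInverse

omit hA in
theorem abs_exp_neg_le {t l : ℝ} (ht : 0 ≤ t) (hl : 0 < l) : |Real.exp (-(l * t))| ≤ 1 := by
  rw [abs_of_pos (Real.exp_pos _), Real.exp_le_one_iff]
  nlinarith

omit hA in
theorem abs_mul_exp_neg_le {t l : ℝ} (ht : 0 < t) (hl : 0 < l) :
    |l * Real.exp (-(l * t))| ≤ 1 / t := by
  rw [abs_of_pos (mul_pos hl (Real.exp_pos _))]
  exact mul_exp_neg_le ht

theorem weaklySingularKernel_semigroup (T : ℝ) :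
    WeaklySingularKernel 1 1 T fun r (x : H) => semigroup A r x :=
  hA.weaklySingularKernel_funCalc (fun t ht l hl => by simpa using abs_exp_neg_le ht.1.le hl)
    fun l _ => by fun_prop

theorem weaklySingularKernel_opSemigroup (T : ℝ) :
    WeaklySingularKernel 0 1 T fun r (x : H) => opSemigroup A r x :=
  hA.weaklySingularKernel_funCalc (fun t ht l hl => by
    rw [zero_sub, Real.rpow_neg_one, one_mul, ← one_div]
    exact abs_mul_exp_neg_le ht.1 hl) fun l _ => by fun_prop

theorem exists_weaklySingularKernel_abelOp {α : ℝ} (hα : α ∈ Ioo (0 : ℝ) 1) (T : ℝ) :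
    ∃ K, 0 ≤ K ∧ WeaklySingularKernel α K T fun r (x : H) => abelOp A α r x := by
  refine ⟨(2 / α + 2 ^ (1 - α)) / Real.Gamma α, ?_, hA.weaklySingularKernel_funCalc
    (fun t ht l hl => abs_abelMultiplier_le hα ht.1 hl)
    fun l hl => continuousOn_abelMultiplier hα.1 hl⟩
  have := Real.Gamma_pos_of_pos hα.1
  have := hα.1
  positivity

variable {l : ℝ} (hl : 0 < l) {e : H} (he : e ∈ opEigenspace A l)

include hl he

theorem inner_semigroup {t : ℝ} (ht : 0 ≤ t) (x : H) :
    inner 𝕜 e (semigroup A t x) = expNeg 𝕜 l t * inner 𝕜 e x :=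
  hA.inner_funCalc (fun _ => abs_exp_neg_le ht) hl he x

theorem inner_opSemigroup {t : ℝ} (ht : 0 < t) (x : H) :
    inner 𝕜 e (opSemigroup A t x) = l * expNeg 𝕜 l t * inner 𝕜 e x := by
  rw [opSemigroup, hA.inner_funCalc (fun _ => abs_mul_exp_neg_le ht) hl he x, RCLike.ofReal_mul]
  rfl

theorem inner_abelOp {α t : ℝ} (hα : α ∈ Ioo (0 : ℝ) 1) (ht : 0 < t) (x : H) :
    inner 𝕜 e (abelOp A α t x) = ((abelMultiplier α t l : ℝ) : 𝕜) * inner 𝕜 e x :=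
  hA.inner_funCalc (fun _ => abs_abelMultiplier_le hα ht) hl he x

end IsPosDefWithCompactInverse

end Kernels

/-! ### The semigroup and the operators `B A⁻¹` -/

section Evolution

open MeasureTheory Filter Topology

variable {𝕜 H : Type*} [RCLike 𝕜] [NormedAddCommGroup H] [InnerProductSpace 𝕜 H]

section Inner

variable [NormedSpace ℝ H] [CompleteSpace H]

theorem inner_intervalIntegral {f : ℝ → H} {s t : ℝ} (e : H) (hf : IntervalIntegrable f volume s t) :
    inner 𝕜 e (∫ r in s..t, f r) = ∫ r in s..t, inner 𝕜 e (f r) :=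
  ((innerSL 𝕜 e).intervalIntegral_comp_comm hf).symm

omit [CompleteSpace H] in
theorem inner_real_smul (e x : H) (c : ℝ) : inner 𝕜 e (c • x) = (c : 𝕜) * inner 𝕜 e x := by
  have := map_real_smul (innerSL 𝕜 e) (innerSL 𝕜 e).continuous c x
  rwa [RCLike.real_smul_eq_coe_mul] at this

omit [CompleteSpace H] in
theorem hasDerivWithinAt_inner_right {f : ℝ → H} {f' : H} {s : Set ℝ} {t : ℝ}
    (hf : HasDerivWithinAt f f' s t) (e : H) :
    HasDerivWithinAt (fun r => inner 𝕜 e (f r)) (inner 𝕜 e f') s t := by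
  let L : H →L[ℝ] 𝕜 :=
    { toFun := fun x => inner 𝕜 e x
      map_add' := fun x y => inner_add_right _ _ _
      map_smul' := fun c x => by
        simp only [inner_real_smul, RingHom.id_apply, RCLike.real_smul_eq_coe_mul]
      cont := (innerSL 𝕜 e).continuous }
  exact L.hasFDerivAt.comp_hasDerivWithinAt t hf

end Inner

variable [CompleteSpace H] {A : H →ₗ.[𝕜] H} (hA : IsPosDefWithCompactInverse A)

section Dominated

variable {B : H →ₗ.[𝕜] H} (hB : IsDominatedBy B A)

include hB

theorem IsDominatedBy.inner_opApply_left {x y : H} (hx : x ∈ A.domain) (hy : y ∈ A.domain) :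
    inner 𝕜 (opApply B x) y = inner 𝕜 x (opApply B y) :=
  _root_.inner_opApply_left hB.selfAdjoint (hB.domain_le hx) (hB.domain_le hy)

/-- `B A⁻¹` is bounded. -/
theorem IsDominatedBy.exists_clm : ∃ S : H →L[𝕜] H, ∀ x, S x = opApply B (hA.inv x) := by
  obtain ⟨C, hC⟩ := hB.bound
  have hval : ∀ x, opApply B (hA.inv x) = B ⟨hA.inv x, hB.domain_le (hA.inv_mem x)⟩ :=
    fun x => opApply_of_mem _
  have hle : ∀ x, ‖opApply B (hA.inv x)‖ ≤ C * ‖x‖ := by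
    intro x
    have h1 : ∀ z ∈ A.domain, ‖inner 𝕜 (opApply B (hA.inv x)) z‖ ≤ C * ‖x‖ * ‖z‖ := by
      intro z hz
      have := hC 2 0 rfl ⟨hA.inv x, hA.inv_mem x⟩ ⟨z, hz⟩
      rw [hval]
      refine this.trans (le_of_eq ?_)
      have h2 : A ⟨hA.inv x, hA.inv_mem x⟩ = x := by
        rw [← opApply_of_mem, hA.opApply_inv]
      change C * ‖A ⟨hA.inv x, hA.inv_mem x⟩‖ * ‖z‖ = _
      rw [h2]
    have h3 : ∀ z : H, ‖inner 𝕜 (opApply B (hA.inv x)) z‖ ≤ C * ‖x‖ * ‖z‖ := fun z =>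
      (isClosed_le (f := fun z => ‖inner 𝕜 (opApply B (hA.inv x)) z‖)
        (g := fun z => C * ‖x‖ * ‖z‖) (by fun_prop) (by fun_prop)).closure_subset_iff.2 h1
        (hA.dense_domain z)
    have h4 := h3 (opApply B (hA.inv x))
    rw [inner_self_eq_norm_sq_to_K, norm_pow, RCLike.norm_ofReal, abs_norm, sq] at h4
    rcases eq_or_lt_of_le (norm_nonneg (opApply B (hA.inv x))) with h5 | h5
    · rw [← h5]
      by_contra hneg
      have h6 := h3 x
      have h7 : opApply B (hA.inv x) = 0 := norm_eq_zero.1 h5.symm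
      rw [h7, inner_zero_left, norm_zero] at h6
      have h8 : x = 0 ∨ 0 < ‖x‖ := by
        rcases eq_or_ne x 0 with h | h
        · exact Or.inl h
        · exact Or.inr (norm_pos_iff.2 h)
      rcases h8 with rfl | h8
      · simp at hneg
      · exact hneg (nonneg_of_mul_nonneg_left h6 h8)
    · exact le_of_mul_le_mul_right h4 h5
  refine ⟨LinearMap.mkContinuous
    { toFun := fun x => opApply B (hA.inv x)
      map_add' := fun x y => ?_
      map_smul' := fun c x => ?_ } C hle, fun x => rfl⟩
  · rw [hval, hval, hval, ← B.map_add]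
    congr 1
    exact Subtype.ext (map_add hA.inv x y)
  · rw [map_smul, opApply_smul (hB.domain_le (hA.inv_mem x))]; rfl

/-- The operator `B A⁻¹`. -/
noncomputable def IsDominatedBy.clm : H →L[𝕜] H := (hB.exists_clm hA).choose

theorem IsDominatedBy.clm_apply (x : H) : hB.clm hA x = opApply B (hA.inv x) :=
  (hB.exists_clm hA).choose_spec x

/-- On `D(A)`, `B` acts weakly as `A (B A⁻¹)†`. -/
theorem IsDominatedBy.inner_opApply_right {l : ℝ} {e : H} (he : e ∈ opEigenspace A l) {x : H}
    (hx : x ∈ A.domain) :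
    inner 𝕜 e (opApply B x) = (l : 𝕜) * inner 𝕜 e (ContinuousLinearMap.adjoint (hB.clm hA) x) := by
  have he' := hA.mem_opEigenspace_iff.1 he
  rw [← hB.inner_opApply_left (mem_opEigenspace.1 he).1 hx,
    ContinuousLinearMap.adjoint_inner_right, hB.clm_apply]
  conv_lhs => rw [he', opApply_smul (hB.domain_le (hA.inv_mem e)), inner_smul_left,
    RCLike.conj_ofReal]

theorem IsDominatedBy.inner_clm {l : ℝ} {e : H} (he : e ∈ opEigenspace A l) (x : H) :
    inner 𝕜 e (hB.clm hA x) =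
      (l : 𝕜) * inner 𝕜 e (ContinuousLinearMap.adjoint (hB.clm hA) (hA.inv x)) := by
  conv_lhs => rw [hB.clm_apply]
  exact hB.inner_opApply_right hA he (hA.inv_mem x)

end Dominated

variable [NormedSpace ℝ H]

include hA

namespace IsPosDefWithCompactInverse

theorem hasDerivAt_semigroup {t : ℝ} (ht : 0 < t) (x : H) :
    HasDerivAt (fun s => semigroup A s x) (-(opSemigroup A t x)) t := by
  have hcont : ContinuousOn (fun s => opSemigroup A s x) (Ioi 0) := fun s hs => by
    have h1 := ((hA.weaklySingularKernel_opSemigroup (s + 1)).apply x).continuousOn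
    have hs0 : (0 : ℝ) < s := hs
    exact (h1.continuousAt (Ioc_mem_nhds hs0 (lt_add_one s))).continuousWithinAt
  have hint : ∀ s : ℝ, 0 < s → IntervalIntegrable (fun s => opSemigroup A s x) volume (t / 2) s :=
    fun s hs => ContinuousOn.intervalIntegrable (hcont.mono fun r hr =>
      (lt_min (half_pos ht) hs).trans_le hr.1)
  have heq : ∀ s : ℝ, 0 < s →
      semigroup A s x = semigroup A (t / 2) x - ∫ r in (t / 2)..s, opSemigroup A r x := by
    intro s hs
    refine hA.ext_inner_opEigenspace fun l hl e he => ?_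
    rw [inner_sub_right, inner_intervalIntegral e (hint s hs), hA.inner_semigroup hl he hs.le,
      hA.inner_semigroup hl he (half_pos ht).le,
      intervalIntegral.integral_congr (g := fun r => (l : 𝕜) * expNeg 𝕜 l r * inner 𝕜 e x)
        fun r hr => hA.inner_opSemigroup hl he
          ((lt_min (half_pos ht) hs).trans_le hr.1) x,
      intervalIntegral.integral_mul_const, integral_expNeg_sub]
    ring
  have h := (intervalIntegral.integral_hasDerivAt_right (hint t ht)
    (hcont.stronglyMeasurableAtFilter isOpen_Ioi t ht)
    (hcont.continuousAt (Ioi_mem_nhds ht))).const_sub (semigroup A (t / 2) x)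
  refine h.congr_of_eventuallyEq ?_
  filter_upwards [Ioi_mem_nhds ht] with s hs using heq s hs

theorem deriv_expSemigroup {t : ℝ} (ht : 0 < t) (x : H) :
    deriv (fun s : ℝ => expSemigroup A s x) t = -(opSemigroup A t x) := by
  refine ((hA.hasDerivAt_semigroup ht x).congr_of_eventuallyEq ?_).deriv
  filter_upwards [Ioi_mem_nhds ht] with s hs using hA.expSemigroup_eq (le_of_lt hs) x

/-! ### The derivative of the semigroup applied to a singular source -/

/-- The convolution of `A exp(-tA)` with `p`, regularized by subtracting from `p(s)` the value
`p(t)`, for which the convolution is `p(t) - exp(-tA) p(t)`. -/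
noncomputable def _root_.opSemigroupConv (A : H →ₗ.[𝕜] H) (p : ℝ → H) (t : ℝ) : H :=
  (∫ s in (0 : ℝ)..t, opSemigroup A (t - s) (p s - p t)) + (p t - semigroup A t (p t))

variable {a M T : ℝ} {p : ℝ → H}

omit [NormedSpace ℝ H] in
/-- The local Lipschitz bound on `p` compensates the singularity of `A exp(-(t-s)A)` at `s = t`. -/
theorem norm_opSemigroup_sub_le (hM : 0 ≤ M) (hp : WeaklySingular a M T p)
    (hlip : ∀ t ∈ Ioc 0 T, ∀ s ∈ Icc (t / 2) t, ‖p s - p t‖ ≤ M * (t / 2) ^ (a - 2) * (t - s))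
    {t : ℝ} (ht : t ∈ Ioc 0 T) {s : ℝ} (hs : s ∈ Ioo 0 t) :
    ‖opSemigroup A (t - s) (p s - p t)‖ ≤
      M * ((t / 2) ^ (a - 2) + 2 / t * (s ^ (a - 1) + t ^ (a - 1))) := by
  have h1 : 0 < t - s := sub_pos.2 hs.2
  have h2 := (hA.weaklySingularKernel_opSemigroup T).bound (t - s)
    ⟨h1, by linarith [hs.1, ht.2]⟩ (p s - p t)
  rw [one_mul, zero_sub, Real.rpow_neg_one] at h2
  refine h2.trans ?_
  rw [inv_mul_le_iff₀ h1]
  have h3 : 0 ≤ (t / 2) ^ (a - 2) := Real.rpow_nonneg (by linarith [ht.1]) _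
  have h4 : 0 ≤ s ^ (a - 1) := Real.rpow_nonneg hs.1.le _
  have h5 : 0 ≤ t ^ (a - 1) := Real.rpow_nonneg ht.1.le _
  have h6 : 0 ≤ 2 / t := by have := ht.1; positivity
  rcases le_total (t / 2) s with h | h
  · refine (hlip t ht s ⟨h, hs.2.le⟩).trans ?_
    have : 0 ≤ (t - s) * (M * (2 / t * (s ^ (a - 1) + t ^ (a - 1)))) := by positivity
    linarith
  · have h7 : 1 ≤ (t - s) * (2 / t) := by
      rw [← mul_div_assoc, le_div_iff₀ ht.1]; linarith
    have h8 : ‖p s - p t‖ ≤ M * (s ^ (a - 1) + t ^ (a - 1)) := by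
      refine (norm_sub_le _ _).trans ?_
      linarith [hp.bound s ⟨hs.1, hs.2.le.trans ht.2⟩, hp.bound t ht]
    have h9 : 0 ≤ M * (s ^ (a - 1) + t ^ (a - 1)) := by positivity
    have h10 : 0 ≤ (t - s) * (M * (t / 2) ^ (a - 2)) := by positivity
    have h11 := mul_le_mul_of_nonneg_right h7 h9
    linarith

omit [NormedSpace ℝ H] in
theorem continuousOn_opSemigroup_sub (hp : ContinuousOn p (Ioc 0 T)) {t : ℝ} (ht : t ∈ Ioc 0 T) :
    ContinuousOn (fun s => opSemigroup A (t - s) (p s - p t)) (Ioo 0 t) :=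
  (hA.weaklySingularKernel_opSemigroup T).continuousOn_integrand
    (x := fun s => p s - p t) (hp.sub continuousOn_const) ht

omit [NormedSpace ℝ H] in
theorem intervalIntegrable_opSemigroup_sub (ha : 0 < a) (hM : 0 ≤ M) (hp : WeaklySingular a M T p)
    (hlip : ∀ t ∈ Ioc 0 T, ∀ s ∈ Icc (t / 2) t, ‖p s - p t‖ ≤ M * (t / 2) ^ (a - 2) * (t - s))
    {t : ℝ} (ht : t ∈ Ioc 0 T) :
    IntervalIntegrable (fun s => opSemigroup A (t - s) (p s - p t)) volume 0 t := by
  refine intervalIntegrable_of_continuousOn_of_le ht.1.le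
    (hA.continuousOn_opSemigroup_sub hp.continuousOn ht) ?_
    fun s hs => hA.norm_opSemigroup_sub_le hM hp hlip ht hs
  have : IntervalIntegrable (fun s : ℝ => s ^ (a - 1)) volume 0 t :=
    intervalIntegral.intervalIntegrable_rpow' (by linarith)
  exact (intervalIntegrable_const.add
    ((this.add intervalIntegrable_const).const_mul (2 / t))).const_mul _

theorem weaklySingular_opSemigroupConv (ha : 0 < a) (hM : 0 ≤ M) (hp : WeaklySingular a M T p)
    (hlip : ∀ t ∈ Ioc 0 T, ∀ s ∈ Icc (t / 2) t, ‖p s - p t‖ ≤ M * (t / 2) ^ (a - 2) * (t - s)) :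
    WeaklySingular a ((2 ^ (2 - a) + 4 + 2 / a) * M) T (opSemigroupConv A p) := by
  set ρ : ℝ → ℝ := fun σ => 2 ^ (2 - a) + 2 * (σ ^ (a - 1) + 1) with hρ
  have hpow : IntervalIntegrable (fun s : ℝ => s ^ (a - 1)) volume 0 1 :=
    intervalIntegral.intervalIntegrable_rpow' (by linarith)
  have hpow2 : IntervalIntegrable (fun s : ℝ => 2 * (s ^ (a - 1) + 1)) volume 0 1 :=
    (hpow.add intervalIntegrable_const).const_mul _
  have hρi : IntervalIntegrable ρ volume 0 1 := intervalIntegrable_const.add hpow2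
  have hρint : ∫ σ in (0 : ℝ)..1, ρ σ = 2 ^ (2 - a) + 2 + 2 / a := by
    rw [hρ, intervalIntegral.integral_add intervalIntegrable_const hpow2,
      intervalIntegral.integral_const_mul,
      intervalIntegral.integral_add hpow intervalIntegrable_const,
      integral_rpow (Or.inl (by linarith))]
    simp [ha.ne']
    ring
  have hcongr : ∀ t, (∫ s in (0 : ℝ)..t, opSemigroup A (t - s) (p s - p t)) =
      ∫ σ in (0 : ℝ)..1, t • opSemigroup A (t - t * σ) (p (t * σ) - p t) := fun t => by
    rw [intervalIntegral.integral_smul]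
    have := intervalIntegral.smul_integral_comp_mul_left (a := 0) (b := 1)
      (fun s : ℝ => opSemigroup A (t - s) (p s - p t)) t
    rw [this, mul_zero, mul_one]
  have hmem : ∀ q ∈ Ioc (0 : ℝ) T ×ˢ Ioo (0 : ℝ) 1, q.1 * q.2 ∈ Ioo 0 q.1 := fun q hq =>
    ⟨mul_pos hq.1.1 hq.2.1, mul_lt_of_lt_one_right hq.1.1 hq.2.2⟩
  have hle : ∀ t ∈ Ioc 0 T, ∀ σ ∈ Ioo (0 : ℝ) 1,
      ‖t • opSemigroup A (t - t * σ) (p (t * σ) - p t)‖ ≤ M * t ^ (a - 1) * ρ σ := by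
    intro t ht σ hσ
    have h1 := hA.norm_opSemigroup_sub_le hM hp hlip ht (hmem (t, σ) ⟨ht, hσ⟩)
    rw [norm_smul, Real.norm_of_nonneg ht.1.le]
    refine (mul_le_mul_of_nonneg_left h1 ht.1.le).trans (le_of_eq ?_)
    have h2 : t * (t / 2) ^ (a - 2) = t ^ (a - 1) * 2 ^ (2 - a) := by
      rw [Real.div_rpow ht.1.le (by norm_num), show a - 1 = 1 + (a - 2) by ring,
        Real.rpow_add ht.1, Real.rpow_one, show a - 2 = -(2 - a) by ring,
        Real.rpow_neg (x := 2) (by norm_num)]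
      field_simp
    simp only
    rw [Real.mul_rpow ht.1.le hσ.1.le, hρ]
    have h3 : t * (2 / t) = 2 := by have := ht.1.ne'; field_simp
    linear_combination M * h2 + M * (t ^ (a - 1) * σ ^ (a - 1) + t ^ (a - 1)) * h3
  have hcont : ContinuousOn (fun t => ∫ s in (0 : ℝ)..t, opSemigroup A (t - s) (p s - p t))
      (Ioc 0 T) := by
    simp only [hcongr]
    refine continuousOn_integral_of_le_mul (b := fun t => M * t ^ (a - 1)) (ρ := ρ) ?_ ?_ hρi ?_ hle
    · refine ContinuousOn.smul (by fun_prop)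
        ((hA.weaklySingularKernel_opSemigroup T).continuousOn.comp
          (f := fun q : ℝ × ℝ => (q.1 - q.1 * q.2, p (q.1 * q.2) - p q.1))
          (ContinuousOn.prodMk (by fun_prop) ((hp.continuousOn.comp (by fun_prop) ?_).sub
            (hp.continuousOn.comp (by fun_prop) fun q hq => hq.1))) ?_)
      · exact fun q hq => ⟨(hmem q hq).1, (hmem q hq).2.le.trans hq.1.2⟩
      · exact fun q hq => ⟨⟨sub_pos.2 (hmem q hq).2, by linarith [(hmem q hq).1, hq.1.2]⟩,
          mem_univ _⟩
    · exact continuousOn_const.mul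
        (ContinuousOn.rpow_const (by fun_prop) fun t ht => Or.inl ht.1.ne')
    · exact fun σ hσ => by have := Real.rpow_nonneg hσ.1.le (a - 1); positivity
  have hS := hA.weaklySingularKernel_semigroup T
  constructor
  · refine hcont.add (hp.continuousOn.sub (hS.continuousOn.comp (f := fun t => (t, p t))
      (continuousOn_id.prodMk hp.continuousOn) fun t ht => ⟨ht, mem_univ _⟩))
  · intro t ht
    have h1 : ‖∫ s in (0 : ℝ)..t, opSemigroup A (t - s) (p s - p t)‖ ≤
        M * t ^ (a - 1) * (2 ^ (2 - a) + 2 + 2 / a) := by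
      rw [hcongr, ← hρint, ← intervalIntegral.integral_const_mul]
      exact norm_intervalIntegral_le_of_Ioo zero_le_one (hρi.const_mul _) (hle t ht)
    have h2 := hS.bound t ht (p t)
    rw [sub_self, Real.rpow_zero, one_mul, one_mul] at h2
    have h3 := hp.bound t ht
    calc _ ≤ ‖∫ s in (0 : ℝ)..t, opSemigroup A (t - s) (p s - p t)‖ +
          (‖p t‖ + ‖semigroup A t (p t)‖) :=
          (norm_add_le _ _).trans (add_le_add le_rfl (norm_sub_le _ _))
      _ ≤ _ := by linarith

/-- Mode by mode, the regularized convolution is the convolution of `l e^{-lt}` with `p`. -/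
theorem inner_opSemigroupConv (ha : 0 < a) (hM : 0 ≤ M) (hp : WeaklySingular a M T p)
    (hlip : ∀ t ∈ Ioc 0 T, ∀ s ∈ Icc (t / 2) t, ‖p s - p t‖ ≤ M * (t / 2) ^ (a - 2) * (t - s))
    {l : ℝ} (hl : 0 < l) {e : H} (he : e ∈ opEigenspace A l) {t : ℝ} (ht : t ∈ Ioc 0 T) :
    inner 𝕜 e (opSemigroupConv A p t) =
      (l : 𝕜) * halfConv (expNeg 𝕜 l) (fun s => inner 𝕜 e (p s)) t := by
  have hε := continuous_expNeg (𝕜 := 𝕜) l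
  have hpi : IntervalIntegrable (fun s => inner 𝕜 e (p s)) volume 0 t :=
    (hp.clm (innerSL 𝕜 e)).intervalIntegrable ha ⟨ht.1.le, ht.2⟩
  have h1 : inner 𝕜 e (∫ s in (0 : ℝ)..t, opSemigroup A (t - s) (p s - p t)) =
      ∫ s in (0 : ℝ)..t, ((l : 𝕜) * (expNeg 𝕜 l (t - s) * inner 𝕜 e (p s)) -
        (l : 𝕜) * expNeg 𝕜 l (t - s) * inner 𝕜 e (p t)) := by
    rw [inner_intervalIntegral e (hA.intervalIntegrable_opSemigroup_sub ha hM hp hlip ht)]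
    refine intervalIntegral.integral_congr_ae ?_
    filter_upwards [ae_mem_Ioo_of_mem_Ioc t] with s h hs
    rw [uIoc_of_le ht.1.le] at hs
    rw [hA.inner_opSemigroup hl he (sub_pos.2 (h hs).2), inner_sub_right]
    ring
  have h2 : ∫ s in (0 : ℝ)..t, (l : 𝕜) * expNeg 𝕜 l (t - s) = 1 - expNeg 𝕜 l t := by
    have := intervalIntegral.integral_comp_sub_left (a := 0) (b := t)
      (fun s => (l : 𝕜) * expNeg 𝕜 l s) t
    rw [this, sub_self, sub_zero, intervalIntegral.integral_const_mul, mul_integral_expNeg]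
  rw [opSemigroupConv, inner_add_right, inner_sub_right, h1, intervalIntegral.integral_sub
    ((hpi.continuousOn_mul (by fun_prop)).const_mul _)
    (Continuous.intervalIntegrable (by fun_prop) _ _), intervalIntegral.integral_mul_const, h2,
    intervalIntegral.integral_const_mul, hA.inner_semigroup hl he ht.1.le, halfConv]
  ring

end IsPosDefWithCompactInverse

end Evolution

/-! ### The Volterra kernel of the problem and uniqueness -/

section Uniqueness

open MeasureTheory Filter Topology

theorem WeaklySingular.of_le {E : Type*} [NormedAddCommGroup E] {a C C' T : ℝ} {x : ℝ → E}
    (hx : WeaklySingular a C T x) (h : C ≤ C') : WeaklySingular a C' T x :=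
  ⟨hx.continuousOn, fun t ht => (hx.bound t ht).trans
    (mul_le_mul_of_nonneg_right h (Real.rpow_nonneg ht.1.le _))⟩

theorem intervalIntegrable_sum_apply {ι E : Type*} [NormedAddCommGroup E] {s : Finset ι}
    {f : ι → ℝ → E} {b t : ℝ} (hf : ∀ i ∈ s, IntervalIntegrable (f i) volume b t) :
    IntervalIntegrable (fun r => ∑ i ∈ s, f i r) volume b t := by
  have := IntervalIntegrable.sum s hf
  rwa [Finset.sum_fn] at this

theorem exists_weaklySingular_abelMultiplier {𝕜 : Type*} [RCLike 𝕜] {α l : ℝ}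
    (hα : α ∈ Ioo (0 : ℝ) 1) (hl : 0 < l) (T : ℝ) : ∃ C, 0 ≤ C ∧
      WeaklySingular α C T fun r => ((abelMultiplier α r l : ℝ) : 𝕜) := by
  refine ⟨(2 / α + 2 ^ (1 - α)) / Real.Gamma α, ?_,
    RCLike.continuous_ofReal.comp_continuousOn (continuousOn_abelMultiplier hα.1 hl),
    fun t ht => ?_⟩
  · have := Real.Gamma_pos_of_pos hα.1
    have := hα.1
    positivity
  · rw [RCLike.norm_ofReal]
    exact abs_abelMultiplier_le hα ht.1 hl

theorem WeaklySingular.intervalIntegrable_halfConv {𝕜 : Type*} [RCLike 𝕜] {f g : ℝ → 𝕜}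
    {a b C K T : ℝ} (hf : WeaklySingular b K T f) (hg : WeaklySingular a C T g) (hK : 0 ≤ K)
    (ha : 0 < a) (hb : 0 < b) {t : ℝ} (ht : t ∈ Icc 0 T) :
    IntervalIntegrable (halfConv f g) volume 0 t :=
  (hf.mul_kernel.weaklySingular hg hK ha hb).intervalIntegrable (add_pos ha hb) ht

variable {𝕜 H : Type*} [RCLike 𝕜] [NormedAddCommGroup H] [InnerProductSpace 𝕜 H] [CompleteSpace H]
  {A : H →ₗ.[𝕜] H} {m : ℕ}

/-- The kernel `κ exp(-rA) - ∑_j (A exp(-·A) * ω_j)(r) S_j`, with `ω_j` the Abel kernels, of the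
Volterra equations for `A v` and for `A v'`. -/
noncomputable def volterraKernel (A : H →ₗ.[𝕜] H) (κ : ℝ) (α : Fin m → ℝ) (S : Fin m → H →L[𝕜] H)
    (r : ℝ) (x : H) : H :=
  semigroup A r ((κ : 𝕜) • x) - ∑ j, abelOp A (α j) r (S j x)

omit [CompleteSpace H] in
theorem volterraKernel_sub (κ : ℝ) (α : Fin m → ℝ) (S : Fin m → H →L[𝕜] H) (r : ℝ) (x y : H) :
    volterraKernel A κ α S r (x - y) = volterraKernel A κ α S r x - volterraKernel A κ α S r y := by
  simp only [volterraKernel, smul_sub, map_sub, Finset.sum_sub_distrib]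
  abel

variable (hA : IsPosDefWithCompactInverse A) {α : Fin m → ℝ} (hα : ∀ j, α j ∈ Ioo (0 : ℝ) 1)
  {κ a T : ℝ} (ha : 0 < a) (ha1 : a ≤ 1) (haα : ∀ j, a ≤ α j) (hT : 0 < T)

include hA hα

include ha1 haα hT in
theorem exists_weaklySingularKernel_volterraKernel (κ : ℝ) (S : Fin m → H →L[𝕜] H) :
    ∃ K, 0 ≤ K ∧ WeaklySingularKernel a K T (volterraKernel A κ α S) := by
  choose K hK0 hK using fun j => hA.exists_weaklySingularKernel_abelOp (hα j) T
  have h1 := ((hA.weaklySingularKernel_semigroup T).comp_clm zero_le_one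
    ((κ : 𝕜) • ContinuousLinearMap.id 𝕜 H)).mono ha1 (by positivity) le_rfl
  have h2 := fun j => ((hK j).comp_clm (hK0 j) (S j)).mono (haα j)
    (mul_nonneg (hK0 j) (norm_nonneg _)) le_rfl
  refine ⟨_, ?_, h1.sub (WeaklySingularKernel.sum fun j _ => h2 j)⟩
  have := fun b : ℝ => Real.rpow_nonneg hT.le b
  exact add_nonneg (mul_nonneg (by positivity) (this _))
    (Finset.sum_nonneg fun j _ => mul_nonneg (mul_nonneg (hK0 j) (norm_nonneg _)) (this _))

theorem inner_volterraKernel {l : ℝ} (hl : 0 < l) {e : H} (he : e ∈ opEigenspace A l)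
    (S : Fin m → H →L[𝕜] H) {r : ℝ} (hr : 0 < r) (x : H) :
    inner 𝕜 e (volterraKernel A κ α S r x) = (κ : 𝕜) * (expNeg 𝕜 l r * inner 𝕜 e x) -
      ∑ j, ((abelMultiplier (α j) r l : ℝ) : 𝕜) * inner 𝕜 e (S j x) := by
  rw [volterraKernel, inner_sub_right, inner_sum, hA.inner_semigroup hl he hr.le, inner_smul_right]
  simp only [fun j => hA.inner_abelOp hl he (hα j) hr]
  ring

variable [NormedSpace ℝ H]

include ha ha1 haα in
theorem inner_integral_volterraKernel {l : ℝ} (hl : 0 < l) {e : H} (he : e ∈ opEigenspace A l)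
    (S : Fin m → H →L[𝕜] H) {C : ℝ} {x : ℝ → H} (hx : WeaklySingular a C T x) {t : ℝ}
    (ht : t ∈ Ioc 0 T) :
    inner 𝕜 e (∫ s in (0 : ℝ)..t, volterraKernel A κ α S (t - s) (x s)) =
      (κ : 𝕜) * halfConv (expNeg 𝕜 l) (fun s => inner 𝕜 e (x s)) t -
      ∑ j, (l : 𝕜) * halfConv (expNeg 𝕜 l)
        (halfConv (abelKernel 𝕜 (α j)) fun s => inner 𝕜 e (S j (x s))) t := by
  have hT : 0 < T := ht.1.trans_le ht.2
  obtain ⟨K, hK0, hK⟩ := exists_weaklySingularKernel_volterraKernel hA hα ha1 haα hT κ S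
  have hxe : WeaklySingular a _ T fun s => inner 𝕜 e (x s) := hx.clm (innerSL 𝕜 e)
  have hxS : ∀ j, WeaklySingular a _ T fun s => inner 𝕜 e (S j (x s)) := fun j =>
    (hx.clm (S j)).clm (innerSL 𝕜 e)
  have hte : t ∈ Icc 0 T := ⟨ht.1.le, ht.2⟩
  have h1 : IntervalIntegrable (fun s => (κ : 𝕜) * (expNeg 𝕜 l (t - s) * inner 𝕜 e (x s)))
      volume 0 t := by
    have := continuous_expNeg (𝕜 := 𝕜) l
    exact ((hxe.intervalIntegrable ha hte).continuousOn_mul (by fun_prop)).const_mul _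
  have h2 : ∀ j, IntervalIntegrable
      (fun s => ((abelMultiplier (α j) (t - s) l : ℝ) : 𝕜) * inner 𝕜 e (S j (x s))) volume 0 t := by
    intro j
    obtain ⟨C, hC0, hC⟩ := exists_weaklySingular_abelMultiplier (𝕜 := 𝕜) (hα j) hl T
    exact hC.mul_kernel.intervalIntegrable (hxS j) hC0 ha (hα j).1 ht
  rw [inner_intervalIntegral e (hK.intervalIntegrable hx hK0 ha ha ht)]
  have h3 : ∫ s in (0 : ℝ)..t, inner 𝕜 e (volterraKernel A κ α S (t - s) (x s)) =
      ∫ s in (0 : ℝ)..t, ((κ : 𝕜) * (expNeg 𝕜 l (t - s) * inner 𝕜 e (x s)) -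
        ∑ j, ((abelMultiplier (α j) (t - s) l : ℝ) : 𝕜) * inner 𝕜 e (S j (x s))) := by
    refine intervalIntegral.integral_congr_ae ?_
    filter_upwards [ae_mem_Ioo_of_mem_Ioc t] with s h hs
    rw [uIoc_of_le ht.1.le] at hs
    exact inner_volterraKernel hA hα hl he S (sub_pos.2 (h hs).2) _
  rw [h3, intervalIntegral.integral_sub h1
    (intervalIntegrable_sum_apply fun j _ => h2 j), intervalIntegral.integral_const_mul,
    intervalIntegral.integral_finsetSum fun j _ => h2 j]
  congr 1
  refine Finset.sum_congr rfl fun j _ => ?_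
  rw [← halfConv_abelMultiplier (hα j).1 ht.1 ((hxS j).intervalIntegrable ha hte)]
  rfl

include ha ha1 haα in
/-- Uniqueness for the homogeneous problem, in the weak form obtained by testing with the
eigenvectors of `A`: variation of constants turns it into a Volterra equation. -/
theorem eq_zero_of_weak_solution (S : Fin m → H →L[𝕜] H) {d : ℝ → H}
    (hd : ContinuousOn d (Icc 0 T)) (hd0 : d 0 = 0)
    (hderiv : ∀ l : ℝ, 0 < l → ∀ e ∈ opEigenspace A l, ∀ t ∈ Ioc 0 T,
      HasDerivWithinAt (fun s => inner 𝕜 e (d s))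
        ((κ : 𝕜) * inner 𝕜 e (d t) -
          ∑ j, halfConv (abelKernel 𝕜 (α j)) (fun s => (l : 𝕜) * inner 𝕜 e (S j (d s))) t -
          l * inner 𝕜 e (d t)) (Ioc 0 T) t) :
    ∀ t ∈ Ioc 0 T, d t = 0 := by
  intro t₁ ht₁
  have hT : 0 < T := ht₁.1.trans_le ht₁.2
  obtain ⟨K, hK0, hK⟩ := exists_weaklySingularKernel_volterraKernel hA hα ha1 haα hT κ S
  obtain ⟨C, hC⟩ := isCompact_Icc.exists_bound_of_continuousOn hd
  have hC0 : 0 ≤ C := (norm_nonneg _).trans (hC 0 ⟨le_rfl, hT.le⟩)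
  have hdw : WeaklySingular a (C * T ^ (1 - a)) T d := by
    have : WeaklySingular 1 C T d := ⟨hd.mono Ioc_subset_Icc_self, fun t ht => by
      rw [sub_self, Real.rpow_zero, mul_one]; exact hC t (Ioc_subset_Icc_self ht)⟩
    exact this.mono ha1 hC0 le_rfl
  refine eq_zero_of_volterra ha ha1 hK0 hK hdw (fun t ht => ?_) t₁ ht₁
  refine hA.ext_inner_opEigenspace fun l hl e he => ?_
  rw [inner_integral_volterraKernel hA hα ha ha1 haα hl he S hdw ht]
  have hte : t ∈ Icc 0 T := ⟨ht.1.le, ht.2⟩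
  have hde : WeaklySingular a _ T fun s => inner 𝕜 e (d s) := hdw.clm (innerSL 𝕜 e)
  have hdS : ∀ j, WeaklySingular a _ T fun s => inner 𝕜 e (S j (d s)) := fun j =>
    (hdw.clm (S j)).clm (innerSL 𝕜 e)
  have hconvi : ∀ j, IntervalIntegrable
      (halfConv (abelKernel 𝕜 (α j)) fun s => inner 𝕜 e (S j (d s))) volume 0 t := fun j =>
    (weaklySingular_abelKernel (hα j).1).intervalIntegrable_halfConv (hdS j)
      (one_div_nonneg.2 (Real.Gamma_pos_of_pos (hα j).1).le) ha (hα j).1 hte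
  set χ : ℝ → 𝕜 := fun s => (κ : 𝕜) * inner 𝕜 e (d s) -
    ∑ j, (l : 𝕜) * halfConv (abelKernel 𝕜 (α j)) (fun s => inner 𝕜 e (S j (d s))) s with hχ
  have hdi := (hde.intervalIntegrable ha hte).const_mul (κ : 𝕜)
  have hχi : IntervalIntegrable χ volume 0 t :=
    hdi.sub (intervalIntegrable_sum_apply fun j _ => (hconvi j).const_mul _)
  have hε := continuous_expNeg (𝕜 := 𝕜) l
  have hcm : ∀ f : ℝ → 𝕜, IntervalIntegrable f volume 0 t →
      IntervalIntegrable (fun s => expNeg 𝕜 l (t - s) * f s) volume 0 t := fun f hf =>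
    hf.continuousOn_mul (by fun_prop)
  have hdu := duhamel_of_hasDerivWithinAt (l := l) (ξ := fun s => inner 𝕜 e (d s)) (χ := χ) ht
    ((innerSL 𝕜 e).continuous.comp_continuousOn hd) (by simp [hd0]) hχi
    (fun s hs => by
      convert! hderiv l hl e he s hs using 1
      simp only [hχ, halfConv, ← intervalIntegral.integral_const_mul]
      simp only [mul_left_comm])
  rw [hdu, halfConv]
  simp only [hχ, mul_sub, Finset.mul_sum]
  rw [intervalIntegral.integral_sub (hcm _ hdi)
    (intervalIntegrable_sum_apply fun j _ => hcm _ ((hconvi j).const_mul _)),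
    intervalIntegral.integral_finsetSum fun j _ => hcm _ ((hconvi j).const_mul _)]
  simp only [halfConv, ← intervalIntegral.integral_const_mul]
  simp only [mul_left_comm, intervalIntegral.integral_const_mul]

end Uniqueness

/-! ### Single modes of the regular solution -/

section Regular

open MeasureTheory Filter Topology

variable {𝕜 : Type*} [RCLike 𝕜] {m : ℕ} {α : Fin m → ℝ} {κ a T l : ℝ}

/-- The mode with eigenvalue `l` of `v'' + A v'`, expressed through the modes `γ'` of `g'`, `φ` of
`A v'` and `ρ j` of `B_j v'`, and the initial values `c j` of the modes of `B_j v`. -/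
noncomputable def modeSource (α : Fin m → ℝ) (κ l : ℝ) (γ' φ : ℝ → 𝕜) (ρ : Fin m → ℝ → 𝕜)
    (c : Fin m → 𝕜) (t : ℝ) : 𝕜 :=
  γ' t + (κ : 𝕜) * ((l : 𝕜)⁻¹ * φ t) -
    ∑ j, (abelKernel 𝕜 (α j) t * c j + halfConv (abelKernel 𝕜 (α j)) (ρ j) t)

variable (hα : ∀ j, α j ∈ Ioo (0 : ℝ) 1) (ha : 0 < a) {γ' φ : ℝ → 𝕜} {ρ : Fin m → ℝ → 𝕜}
  {C₁ C₂ : ℝ} {C₃ : Fin m → ℝ} (hγ : WeaklySingular a C₁ T γ') (hφ : WeaklySingular a C₂ T φ)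
  (hρ : ∀ j, WeaklySingular a (C₃ j) T (ρ j)) (c : Fin m → 𝕜)

include hα ha hρ

theorem intervalIntegrable_halfConv_abelKernel (j : Fin m) {t : ℝ} (ht : t ∈ Icc 0 T) :
    IntervalIntegrable (halfConv (abelKernel 𝕜 (α j)) (ρ j)) volume 0 t :=
  (weaklySingular_abelKernel (hα j).1).intervalIntegrable_halfConv (hρ j)
    (one_div_nonneg.2 (Real.Gamma_pos_of_pos (hα j).1).le) ha (hα j).1 ht

theorem intervalIntegrable_modeSource_summand (j : Fin m) {t : ℝ} (ht : t ∈ Icc 0 T) :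
    IntervalIntegrable (fun s => abelKernel 𝕜 (α j) s * c j +
      halfConv (abelKernel 𝕜 (α j)) (ρ j) s) volume 0 t :=
  ((intervalIntegrable_abelKernel (hα j).1 ht.1).mul_const _).add
    (intervalIntegrable_halfConv_abelKernel hα ha hρ j ht)

include hγ hφ

theorem intervalIntegrable_modeSource {t : ℝ} (ht : t ∈ Icc 0 T) :
    IntervalIntegrable (modeSource α κ l γ' φ ρ c) volume 0 t :=
  ((hγ.intervalIntegrable ha ht).add
    (((hφ.intervalIntegrable ha ht).const_mul _).const_mul _)).sub
    (intervalIntegrable_sum_apply fun j _ =>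
      intervalIntegrable_modeSource_summand hα ha hρ c j ht)

/-- The Volterra equation for the mode `φ` of `A v'` is the variation of constants formula for the
mode `φ / l` of `v'`. -/
theorem inv_mul_eq_add_integral_modeSource (hl : 0 < l) {c₁ ψ₀ : 𝕜}
    (heq : ∀ t ∈ Ioc 0 T, φ t = -((l : 𝕜) * expNeg 𝕜 l t * c₁) +
      (l : 𝕜) * halfConv (expNeg 𝕜 l) γ' t +
      ((κ : 𝕜) * (expNeg 𝕜 l t * ψ₀) - ∑ j, ((abelMultiplier (α j) t l : ℝ) : 𝕜) * c j) +
      ((κ : 𝕜) * halfConv (expNeg 𝕜 l) φ t -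
        ∑ j, (l : 𝕜) * halfConv (expNeg 𝕜 l) (halfConv (abelKernel 𝕜 (α j)) (ρ j)) t))
    {t : ℝ} (ht : t ∈ Ioc 0 T) :
    (l : 𝕜)⁻¹ * φ t = (-c₁ + (κ : 𝕜) * ((l : 𝕜)⁻¹ * ψ₀)) +
      ∫ s in (0 : ℝ)..t, (modeSource α κ l γ' φ ρ c s - φ s) := by
  have hl0 : (l : 𝕜) ≠ 0 := RCLike.ofReal_ne_zero.2 hl.ne'
  have hε := continuous_expNeg (𝕜 := 𝕜) l
  have hte : t ∈ Icc 0 T := ⟨ht.1.le, ht.2⟩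
  have hduh := eq_add_integral_of_duhamel (𝕜 := 𝕜) (l := l) (y := fun s => (l : 𝕜)⁻¹ * φ s)
    (c := -c₁ + (κ : 𝕜) * ((l : 𝕜)⁻¹ * ψ₀)) ht.1
    (intervalIntegrable_modeSource (κ := κ) (l := l) hα ha hγ hφ hρ c hte)
    ((hφ.intervalIntegrable ha hte).const_mul _) ?_
  · simpa only [mul_inv_cancel_left₀ hl0] using hduh
  intro s hs
  have hs' : s ∈ Ioc 0 T := ⟨hs.1, hs.2.trans ht.2⟩
  have hse : s ∈ Icc 0 T := ⟨hs.1.le, hs'.2⟩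
  have hcm : ∀ f : ℝ → 𝕜, IntervalIntegrable f volume 0 s →
      IntervalIntegrable (fun r => expNeg 𝕜 l (s - r) * f r) volume 0 s := fun f hf =>
    hf.continuousOn_mul (by fun_prop)
  have hγi := hγ.intervalIntegrable ha hse
  have hφi := ((hφ.intervalIntegrable ha hse).const_mul (l : 𝕜)⁻¹).const_mul (κ : 𝕜)
  have hki := fun j => intervalIntegrable_halfConv_abelKernel hα ha hρ j hse
  have hai := fun j => (intervalIntegrable_abelKernel (𝕜 := 𝕜) (hα j).1 hse.1).mul_const (c j)
  have hsi := fun j => intervalIntegrable_modeSource_summand hα ha hρ c j hse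
  have hconv : halfConv (expNeg 𝕜 l) (modeSource α κ l γ' φ ρ c) s =
      halfConv (expNeg 𝕜 l) γ' s + (κ : 𝕜) * ((l : 𝕜)⁻¹ * halfConv (expNeg 𝕜 l) φ s) -
      (∑ j, halfConv (expNeg 𝕜 l) (abelKernel 𝕜 (α j)) s * c j +
        ∑ j, halfConv (expNeg 𝕜 l) (halfConv (abelKernel 𝕜 (α j)) (ρ j)) s) := by
    have h1 : ∀ j, halfConv (expNeg 𝕜 l) (fun s => abelKernel 𝕜 (α j) s * c j +
        halfConv (abelKernel 𝕜 (α j)) (ρ j) s) s =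
        halfConv (expNeg 𝕜 l) (abelKernel 𝕜 (α j)) s * c j +
          halfConv (expNeg 𝕜 l) (halfConv (abelKernel 𝕜 (α j)) (ρ j)) s := fun j => by
      rw [halfConv]
      simp only [mul_add]
      rw [intervalIntegral.integral_add (hcm _ (hai j)) (hcm _ (hki j))]
      simp only [← mul_assoc, intervalIntegral.integral_mul_const]
      rfl
    rw [← Finset.sum_add_distrib, ← Finset.sum_congr rfl fun j _ => h1 j, halfConv]
    have h3 : ∫ x in (0 : ℝ)..s, expNeg 𝕜 l (s - x) * (γ' x + (κ : 𝕜) * ((l : 𝕜)⁻¹ * φ x)) =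
        halfConv (expNeg 𝕜 l) γ' s +
          ∫ x in (0 : ℝ)..s, expNeg 𝕜 l (s - x) * ((κ : 𝕜) * ((l : 𝕜)⁻¹ * φ x)) := by
      simp only [mul_add]
      exact intervalIntegral.integral_add (hcm _ hγi) (hcm _ hφi)
    simp only [modeSource, mul_sub, Finset.mul_sum]
    rw [intervalIntegral.integral_sub (hcm _ (hγi.add hφi))
        (intervalIntegrable_sum_apply fun j _ => hcm _ (hsi j)), h3,
      intervalIntegral.integral_finsetSum fun j _ => hcm _ (hsi j)]
    have h2 : ∫ x in (0 : ℝ)..s, expNeg 𝕜 l (s - x) * ((κ : 𝕜) * ((l : 𝕜)⁻¹ * φ x)) =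
        (κ : 𝕜) * ((l : 𝕜)⁻¹ * halfConv (expNeg 𝕜 l) φ s) := by
      simp only [halfConv, ← intervalIntegral.integral_const_mul]
      simp only [mul_left_comm]
    rw [h2]
    rfl
  rw [hconv, heq s hs']
  simp only [ofReal_abelMultiplier, mul_assoc, ← Finset.mul_sum]
  field_simp
  ring

theorem integral_modeSource_sub {t : ℝ} (ht : t ∈ Ioc 0 T) :
    ∫ s in (0 : ℝ)..t, (modeSource α κ l γ' φ ρ c s - φ s) =
      (∫ s in (0 : ℝ)..t, γ' s) + (κ : 𝕜) * ((l : 𝕜)⁻¹ * ∫ s in (0 : ℝ)..t, φ s) -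
      ∑ j, halfConv (abelKernel 𝕜 (α j)) (fun s => c j + ∫ r in (0 : ℝ)..s, ρ j r) t -
      ∫ s in (0 : ℝ)..t, φ s := by
  have hte : t ∈ Icc 0 T := ⟨ht.1.le, ht.2⟩
  have hγi := hγ.intervalIntegrable ha hte
  have hφi := hφ.intervalIntegrable ha hte
  have hφi' := (hφi.const_mul (l : 𝕜)⁻¹).const_mul (κ : 𝕜)
  have hki := fun j => intervalIntegrable_halfConv_abelKernel hα ha hρ j hte
  have hai := fun j => intervalIntegrable_abelKernel (𝕜 := 𝕜) (hα j).1 hte.1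
  have hsi := fun j => intervalIntegrable_modeSource_summand hα ha hρ c j hte
  have hρi := fun j => (hρ j).intervalIntegrable ha hte
  rw [intervalIntegral.integral_sub (intervalIntegrable_modeSource hα ha hγ hφ hρ c hte) hφi]
  simp only [modeSource]
  rw [intervalIntegral.integral_sub (hγi.add hφi')
      (intervalIntegrable_sum_apply fun j _ => hsi j),
    intervalIntegral.integral_add hγi hφi', intervalIntegral.integral_const_mul,
    intervalIntegral.integral_const_mul, intervalIntegral.integral_finsetSum fun j _ => hsi j]
  congr 2
  refine Finset.sum_congr rfl fun j _ => ?_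
  rw [intervalIntegral.integral_add ((hai j).mul_const _) (hki j),
    integral_halfConv' ht.1 (hai j) (hρi j), ← halfConv_one, halfConv_comm, halfConv, halfConv, halfConv]
  have hprim : ContinuousOn (fun r => ∫ s in (0 : ℝ)..r, ρ j s) (uIcc 0 t) :=
    intervalIntegral.continuousOn_primitive_interval' (hρi j) left_mem_uIcc
  have hωi : IntervalIntegrable (fun s => abelKernel 𝕜 (α j) (t - s)) volume 0 t := by
    have := (hai j).comp_sub_left t
    rw [sub_zero, sub_self] at this
    exact this.symm
  rw [← intervalIntegral.integral_add ((hωi.mul_const _).mul_const _)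
    (hωi.mul_continuousOn hprim)]
  refine intervalIntegral.integral_congr fun s _ => ?_
  ring

end Regular

/-! ### Construction of the regular solution -/

section Existence

open MeasureTheory Filter Topology

variable {𝕜 H : Type*} [RCLike 𝕜] [NormedAddCommGroup H] [InnerProductSpace 𝕜 H] [CompleteSpace H]
  {A : H →ₗ.[𝕜] H} {m : ℕ} (hA : IsPosDefWithCompactInverse A) {α : Fin m → ℝ}
  (hα : ∀ j, α j ∈ Ioo (0 : ℝ) 1) {κ a T : ℝ} (ha : 0 < a) (ha1 : a ≤ 1) (haα : ∀ j, a ≤ α j)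
  (hT : 0 < T) [NormedSpace ℝ H]

include hα ha haα hT in
omit [CompleteSpace H] in
/-- The derivative of `ω_j * S w`, where `w' = q` and `w(0) = w₀`. -/
theorem exists_weaklySingular_abel_smul_add (j : Fin m) (S : H →L[𝕜] H) :
    ∃ D, 0 ≤ D ∧ ∀ (C : ℝ) (w₀ : H) (q : ℝ → H), ‖w₀‖ ≤ C → WeaklySingular a C T q →
      WeaklySingular a (D * C) T fun t => abelKernel 𝕜 (α j) t • S w₀ +
        ∫ s in (0 : ℝ)..t, abelKernel 𝕜 (α j) (t - s) • S (q s) := by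
  have hΓ := one_div_nonneg.2 (Real.Gamma_pos_of_pos (hα j).1).le
  have hTp := fun b : ℝ => Real.rpow_nonneg hT.le b
  have hker : WeaklySingularKernel (α j) (1 / Real.Gamma (α j)) T
      fun r (x : H) => abelKernel 𝕜 (α j) r • x := (weaklySingular_abelKernel (hα j).1).smul_kernel
  have hB := betaInt_nonneg a (α j)
  refine ⟨1 / Real.Gamma (α j) * ‖S‖ * T ^ (α j - a) +
    1 / Real.Gamma (α j) * ‖S‖ * betaInt a (α j) * T ^ (α j), ?_, fun C w₀ q hw hq => ?_⟩
  · have := hTp (α j - a)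
    have := hTp (α j)
    positivity
  have hC : 0 ≤ C := (norm_nonneg _).trans hw
  rw [add_mul]
  refine WeaklySingular.add ?_ ?_
  · refine (hker.apply (S w₀)).mono (haα j) (by positivity) ?_
    have h1 : ‖S w₀‖ ≤ ‖S‖ * C := (S.le_opNorm _).trans (by gcongr)
    calc _ ≤ 1 / Real.Gamma (α j) * (‖S‖ * C) * T ^ (α j - a) := by
          have := hTp (α j - a)
          gcongr
      _ = _ := by ring
  · refine (hker.weaklySingular (hq.clm S) hΓ ha (hα j).1).mono
      (by linarith [(hα j).1]) (by positivity) (le_of_eq ?_)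
    rw [show a + α j - a = α j by ring]
    ring

include hA hα ha ha1 haα hT in
/-- The regular solution is constructed from its second-order part: `q`, which is to be `A v'`,
solves a weakly singular Volterra equation; then `w = w₀ + ∫ q` is `A v` and `z` is `v''`. -/
theorem exists_regular_solution (κ : ℝ) (S : Fin m → H →L[𝕜] H) :
    ∃ K, 0 ≤ K ∧ ∀ (M : ℝ) (g p : ℝ → H) (w₀ : H), 0 ≤ M → ContinuousOn g (Icc 0 T) →
      (∀ t ∈ Ioc 0 T, HasDerivWithinAt g (p t) (Ioc 0 T) t) → WeaklySingular a M T p →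
      (∀ t ∈ Ioc 0 T, ∀ s ∈ Icc (t / 2) t, ‖p s - p t‖ ≤ M * (t / 2) ^ (a - 2) * (t - s)) →
      (∀ t ∈ Ioc 0 T, ‖opSemigroup A t (w₀ - g 0)‖ ≤ M * t ^ (a - 1)) →
      ∃ q z : ℝ → H, WeaklySingular a (K * (‖w₀‖ + M)) T q ∧
        WeaklySingular a (K * (‖w₀‖ + M)) T z ∧
        (∀ t ∈ Ioc 0 T, HasDerivWithinAt (fun t => hA.inv (q t)) (z t) (Ioc 0 T) t) ∧
        ∀ l : ℝ, 0 < l → ∀ e ∈ opEigenspace A l, ∀ t ∈ Ioc 0 T,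
          inner 𝕜 e (hA.inv (q t)) = inner 𝕜 e (g t) +
            (κ : 𝕜) * inner 𝕜 e (hA.inv (w₀ + ∫ s in (0 : ℝ)..t, q s)) -
            ∑ j, halfConv (abelKernel 𝕜 (α j))
              (fun s => inner 𝕜 e (S j (w₀ + ∫ r in (0 : ℝ)..s, q r))) t -
            inner 𝕜 e (w₀ + ∫ s in (0 : ℝ)..t, q s) := by
  obtain ⟨Kk, hKk0, hKk⟩ := exists_weaklySingularKernel_volterraKernel hA hα ha1 haα hT κ S
  obtain ⟨D, hD0, hD⟩ := exists_volterra (H := H) ha ha1 hT Kk hKk0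
  choose DV hDV0 hDV using fun j =>
    exists_weaklySingular_abel_smul_add (𝕜 := 𝕜) hα ha haα hT j (S j)
  set cP : ℝ := 2 ^ (2 - a) + 4 + 2 / a with hcP
  have hcP0 : 0 ≤ cP := by positivity
  set Ch : ℝ := 1 + cP + Kk with hCh
  have hCh0 : 0 ≤ Ch := by positivity
  set Kq : ℝ := D * Ch + 1 with hKq
  have hKq0 : 0 ≤ Kq := by positivity
  set Kz : ℝ := (1 + ‖(κ : 𝕜) • hA.inv‖ * Kq + ∑ j, DV j * Kq) + Kq with hKz
  have hsum0 : 0 ≤ ∑ j, DV j * Kq := Finset.sum_nonneg fun j _ => mul_nonneg (hDV0 j) hKq0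
  have hqz : Kq ≤ Kz := by
    have : 0 ≤ ‖(κ : 𝕜) • hA.inv‖ * Kq := by positivity
    linarith
  refine ⟨Kz, hKq0.trans hqz, fun M g p w₀ hM hgc hgd hp hlip hE => ?_⟩
  set N := ‖w₀‖ + M with hN
  have hN0 : 0 ≤ N := by positivity
  have hMN : M ≤ N := by linarith [norm_nonneg w₀]
  have hwN : ‖w₀‖ ≤ N := by linarith
  -- the right-hand side of the Volterra equation
  have hh : WeaklySingular a (Ch * N) T fun t => -(opSemigroup A t (w₀ - g 0)) +
      opSemigroupConv A p t + volterraKernel A κ α S t w₀ := by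
    have h1 : WeaklySingular a M T fun t => opSemigroup A t (w₀ - g 0) :=
      ⟨((hA.weaklySingularKernel_opSemigroup T).apply _).continuousOn, hE⟩
    refine ((h1.neg.add (hA.weaklySingular_opSemigroupConv ha hM hp hlip)).add
      (hKk.apply w₀)).of_le ?_
    have h2 : cP * M ≤ cP * N := by gcongr
    have h3 : Kk * ‖w₀‖ ≤ Kk * N := by gcongr
    rw [hCh]
    linarith
  obtain ⟨q, hq', hqeq⟩ := hD _ hKk (volterraKernel_sub κ α S) (Ch * N) _ (by positivity) hh
  have hq : WeaklySingular a (Kq * N) T q := hq'.of_le (by rw [hKq]; linarith)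
  have hNq : ‖w₀‖ ≤ Kq * N := by
    have : 0 ≤ D * Ch * N := by positivity
    rw [hKq]; linarith
  have hV := fun j => hDV j (Kq * N) w₀ q hNq hq
  set V : Fin m → ℝ → H := fun j t => abelKernel 𝕜 (α j) t • S j w₀ +
    ∫ s in (0 : ℝ)..t, abelKernel 𝕜 (α j) (t - s) • S j (q s) with hVdef
  set z : ℝ → H := fun t => p t + ((κ : 𝕜) • hA.inv) (q t) - ∑ j, V j t - q t with hzdef
  have hz : WeaklySingular a (Kz * N) T z := by
    refine (((hp.add (hq.clm ((κ : 𝕜) • hA.inv))).sub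
      (WeaklySingular.sum fun j _ => hV j)).sub hq).of_le ?_
    have h1 : ∑ j, DV j * (Kq * N) = (∑ j, DV j * Kq) * N := by
      simp only [Finset.sum_mul, mul_assoc]
    rw [h1, hKz]
    linarith
  have hqi : ∀ t ∈ Icc 0 T, IntervalIntegrable q volume 0 t :=
    fun t ht => hq.intervalIntegrable ha ht
  have hzi : ∀ t ∈ Icc 0 T, IntervalIntegrable z volume 0 t :=
    fun t ht => hz.intervalIntegrable ha ht
  -- everything is tested with the eigenvectors of `A`
  have hpe : ∀ e, WeaklySingular a _ T fun t => inner 𝕜 e (p t) := fun e => hp.clm (innerSL 𝕜 e)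
  have hqe : ∀ e, WeaklySingular a _ T fun t => inner 𝕜 e (q t) := fun e => hq.clm (innerSL 𝕜 e)
  have hqS : ∀ e j, WeaklySingular a _ T fun t => inner 𝕜 e (S j (q t)) := fun e j =>
    (hq.clm (S j)).clm (innerSL 𝕜 e)
  have hze : ∀ l : ℝ, 0 < l → ∀ e ∈ opEigenspace A l, ∀ t ∈ Ioc 0 T, inner 𝕜 e (z t) =
      modeSource α κ l (fun t => inner 𝕜 e (p t)) (fun t => inner 𝕜 e (q t))
        (fun j t => inner 𝕜 e (S j (q t))) (fun j => inner 𝕜 e (S j w₀)) t - inner 𝕜 e (q t) := by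
    intro l hl e he t ht
    simp only [hzdef, modeSource, inner_sub_right, inner_add_right, inner_sum,
      smul_apply, inner_smul_right, hA.inner_inv_right hl he]
    congr 2
    refine Finset.sum_congr rfl fun j _ => ?_
    have hker : WeaklySingularKernel (α j) (1 / Real.Gamma (α j)) T
      fun r (x : H) => abelKernel 𝕜 (α j) r • x := (weaklySingular_abelKernel (hα j).1).smul_kernel
    simp only [hVdef]
    rw [inner_add_right, inner_smul_right, inner_intervalIntegral e (hker.intervalIntegrable
      (hq.clm (S j)) (one_div_nonneg.2 (Real.Gamma_pos_of_pos (hα j).1).le) ha (hα j).1 ht)]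
    simp only [inner_smul_right]
    rfl
  have hcore : ∀ l : ℝ, 0 < l → ∀ e ∈ opEigenspace A l, ∀ t ∈ Ioc 0 T,
      inner 𝕜 e (hA.inv (q t)) = (-inner 𝕜 e (w₀ - g 0) + (κ : 𝕜) * inner 𝕜 e (hA.inv w₀)) +
        ∫ s in (0 : ℝ)..t, inner 𝕜 e (z s) := by
    intro l hl e he t ht
    have h1 := inv_mul_eq_add_integral_modeSource (κ := κ) hα ha (hpe e) (hqe e) (hqS e)
      (fun j => inner 𝕜 e (S j w₀)) hl (c₁ := inner 𝕜 e (w₀ - g 0)) (ψ₀ := inner 𝕜 e w₀)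
      (fun s hs => by
        rw [hqeq s hs, inner_add_right, inner_add_right, inner_add_right, inner_neg_right,
          hA.inner_opSemigroup hl he hs.1, hA.inner_opSemigroupConv ha hM hp hlip hl he hs,
          inner_volterraKernel hA hα hl he S hs.1,
          inner_integral_volterraKernel hA hα ha ha1 haα hl he S hq hs]) ht
    rw [hA.inner_inv_right hl he, hA.inner_inv_right hl he, h1]
    congr 1
    refine intervalIntegral.integral_congr_ae (Eventually.of_forall fun s hs => ?_)
    rw [uIoc_of_le ht.1.le] at hs
    exact (hze l hl e he s ⟨hs.1, hs.2.trans ht.2⟩).symm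
  refine ⟨q, z, hq.of_le (by gcongr), hz, fun t ht => ?_, fun l hl e he t ht => ?_⟩
  · refine hz.hasDerivWithinAt_integral (c := -(w₀ - g 0) + (κ : 𝕜) • hA.inv w₀) ha
      (fun s hs => hA.ext_inner_opEigenspace fun l hl e he => ?_) ht
    rw [hcore l hl e he s hs, inner_add_right, inner_add_right, inner_neg_right, inner_smul_right,
      inner_intervalIntegral e (hzi s ⟨hs.1.le, hs.2⟩)]
  · have hte : t ∈ Icc 0 T := ⟨ht.1.le, ht.2⟩
    have hgint : ∫ s in (0 : ℝ)..t, inner 𝕜 e (p s) = inner 𝕜 e (g t) - inner 𝕜 e (g 0) := by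
      refine intervalIntegral.integral_eq_sub_of_hasDerivAt_of_le ht.1.le
        (f := fun s => inner 𝕜 e (g s)) ?_ (fun s hs => ?_)
        ((hpe e).intervalIntegrable ha hte)
      · exact (innerSL 𝕜 e).continuous.comp_continuousOn (hgc.mono (Icc_subset_Icc_right ht.2))
      · exact (hasDerivWithinAt_inner_right (hgd s ⟨hs.1, hs.2.le.trans ht.2⟩) e).hasDerivAt
          (Filter.mem_of_superset (Ioo_mem_nhds hs.1 (hs.2.trans_le ht.2)) Ioo_subset_Ioc_self)
    have h1 : ∫ s in (0 : ℝ)..t, inner 𝕜 e (z s) = ∫ s in (0 : ℝ)..t,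
        (modeSource α κ l (fun t => inner 𝕜 e (p t)) (fun t => inner 𝕜 e (q t))
          (fun j t => inner 𝕜 e (S j (q t))) (fun j => inner 𝕜 e (S j w₀)) s -
            inner 𝕜 e (q s)) := by
      refine intervalIntegral.integral_congr_ae (Eventually.of_forall fun s hs => ?_)
      rw [uIoc_of_le ht.1.le] at hs
      exact hze l hl e he s ⟨hs.1, hs.2.trans ht.2⟩
    have h2 : ∀ j, halfConv (abelKernel 𝕜 (α j))
        (fun s => inner 𝕜 e (S j w₀) + ∫ r in (0 : ℝ)..s, inner 𝕜 e (S j (q r))) t =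
        halfConv (abelKernel 𝕜 (α j))
          (fun s => inner 𝕜 e (S j (w₀ + ∫ r in (0 : ℝ)..s, q r))) t := by
      intro j
      refine halfConv_congr_right ht.1.le fun s hs => ?_
      have hse : s ∈ Icc 0 T := ⟨hs.1.le, hs.2.trans ht.2⟩
      rw [map_add, inner_add_right, ← (S j).intervalIntegral_comp_comm (hqi s hse),
        inner_intervalIntegral e ((hq.clm (S j)).intervalIntegrable ha hse)]
    rw [hcore l hl e he t ht, h1, integral_modeSource_sub hα ha (hpe e) (hqe e) (hqS e) _ ht,
      hgint, Finset.sum_congr rfl fun j _ => h2 j, map_add, inner_add_right, inner_add_right,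
      hA.inner_inv_right hl he, hA.inner_inv_right hl he, inner_intervalIntegral e (hqi t hte),
      inner_sub_right]
    ring

end Existence

/-! ### Identification with the given solution -/

section Identification

open MeasureTheory Filter Topology

variable {𝕜 H : Type*} [RCLike 𝕜] [NormedAddCommGroup H] [InnerProductSpace 𝕜 H]
  [CompleteSpace H] {A : H →ₗ.[𝕜] H} {m : ℕ}

theorem intervalIntegrable_halfConv_integrand {α : ℝ} (hα : 0 < α) {t : ℝ} (ht : 0 ≤ t)
    {x : ℝ → 𝕜} (hx : ContinuousOn x (Icc 0 t)) :
    IntervalIntegrable (fun s => abelKernel 𝕜 α (t - s) * x s) volume 0 t := by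
  have h := (intervalIntegrable_abelKernel (𝕜 := 𝕜) hα ht).comp_sub_left t
  rw [sub_zero, sub_self] at h
  exact h.symm.mul_continuousOn (by rwa [uIcc_of_le ht])

variable [NormedSpace ℝ H] [IsScalarTower ℝ 𝕜 H]

/-- The equation for `v = e^{κt} u`, tested with an eigenvector of `A`. -/
theorem IsTemperedSolution.hasDerivWithinAt_inner (hA : IsPosDefWithCompactInverse A)
    {B : Fin m → H →ₗ.[𝕜] H} (hB : ∀ j, IsDominatedBy (B j) A) {α : Fin m → ℝ} {κ T : ℝ}
    {f u g v : ℝ → H} {u₀ : H} (hu : IsTemperedSolution A B α κ T f u₀ u)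
    (hg : ∀ t, g t = Real.exp (κ * t) • f t) (hv : ∀ t, v t = Real.exp (κ * t) • u t)
    {l : ℝ} {e : H} (he : e ∈ opEigenspace A l) {t : ℝ} (ht : t ∈ Ioc 0 T) :
    HasDerivWithinAt (fun s => inner 𝕜 e (v s)) ((κ : 𝕜) * inner 𝕜 e (v t) + inner 𝕜 e (g t) -
      l * inner 𝕜 e (v t) - ∑ j, halfConv (abelKernel 𝕜 (α j)) (fun s => (l : 𝕜) *
        inner 𝕜 e (ContinuousLinearMap.adjoint ((hB j).clm hA) (v s))) t) (Ioc 0 T) t := by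
  obtain ⟨u', hu', heq⟩ := hu.equation t ht
  have he' := mem_opEigenspace.1 he
  have hexp : HasDerivWithinAt (fun s => Real.exp (κ * s)) (Real.exp (κ * t) * κ) (Ioc 0 T) t := by
    have := ((hasDerivAt_id t).const_mul κ).exp
    simpa using this.hasDerivWithinAt
  have hvd : HasDerivWithinAt v (Real.exp (κ * t) • u' + (Real.exp (κ * t) * κ) • u t)
      (Ioc 0 T) t := by
    rw [funext hv]
    exact hexp.smul hu'
  have hA' : inner 𝕜 e (opApply A (u t)) = (l : 𝕜) * inner 𝕜 e (u t) := by
    rw [← inner_opApply_left hA.selfAdjoint he'.1 (hu.mem_domain t ht), he'.2, inner_smul_left,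
      RCLike.conj_ofReal]
  have hconv : ∀ j, ((Real.exp (κ * t) : ℝ) : 𝕜) * inner 𝕜 e
      (∫ s in (0 : ℝ)..t, temperedKernel κ (α j) (t - s) • opApply (B j) (u s)) =
      halfConv (abelKernel 𝕜 (α j)) (fun s => (l : 𝕜) *
        inner 𝕜 e (ContinuousLinearMap.adjoint ((hB j).clm hA) (v s))) t := by
    intro j
    rw [inner_intervalIntegral e (hu.integrable j t ht), ← intervalIntegral.integral_const_mul,
      halfConv]
    refine intervalIntegral.integral_congr_ae (Eventually.of_forall fun s hs => ?_)
    rw [uIoc_of_le ht.1.le] at hs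
    rw [inner_real_smul, (hB j).inner_opApply_right hA he
      (hu.mem_domain s ⟨hs.1, hs.2.trans ht.2⟩), hv s, RCLike.real_smul_eq_coe_smul (K := 𝕜),
      map_smul, inner_smul_right, temperedKernel, abelKernel]
    have h1 : Real.exp (κ * t) * (Real.exp (-(κ * (t - s))) * (t - s) ^ (α j - 1) /
        Real.Gamma (α j)) = (t - s) ^ (α j - 1) / Real.Gamma (α j) * Real.exp (κ * s) := by
      rw [mul_div_assoc, ← mul_assoc, ← Real.exp_add, mul_comm]
      ring_nf
    have h2 := congrArg (fun r : ℝ => (r : 𝕜)) h1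
    simp only [RCLike.ofReal_mul] at h2 ⊢
    linear_combination ((l : 𝕜) * inner 𝕜 e
      (ContinuousLinearMap.adjoint ((hB j).clm hA) (u s))) * h2
  have h := hasDerivWithinAt_inner_right (𝕜 := 𝕜) hvd e
  convert! h using 1
  rw [hg t, ← heq, hv t]
  simp only [inner_real_smul, inner_add_right, inner_sum, mul_add, Finset.mul_sum, hconv, hA']
  push_cast
  ring

/-- The solution is the regular one, by uniqueness for weak solutions. -/
theorem IsTemperedSolution.eq_regular_solution (hA : IsPosDefWithCompactInverse A)
    {B : Fin m → H →ₗ.[𝕜] H} (hB : ∀ j, IsDominatedBy (B j) A) {α : Fin m → ℝ}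
    (hα : ∀ j, α j ∈ Ioo (0 : ℝ) 1) {κ a T : ℝ} (ha : 0 < a) (ha1 : a ≤ 1) (haα : ∀ j, a ≤ α j)
    {f u g v : ℝ → H} {u₀ : A.domain} (hu : IsTemperedSolution A B α κ T f u₀ u)
    (hg : ∀ t, g t = Real.exp (κ * t) • f t) (hv : ∀ t, v t = Real.exp (κ * t) • u t)
    {C : ℝ} {q : ℝ → H} (hq : WeaklySingular a C T q)
    (hqeq : ∀ l : ℝ, 0 < l → ∀ e ∈ opEigenspace A l, ∀ t ∈ Ioc 0 T,
      inner 𝕜 e (hA.inv (q t)) = inner 𝕜 e (g t) +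
        (κ : 𝕜) * inner 𝕜 e (hA.inv (A u₀ + ∫ s in (0 : ℝ)..t, q s)) -
        ∑ j, halfConv (abelKernel 𝕜 (α j))
          (fun s => inner 𝕜 e ((hB j).clm hA (A u₀ + ∫ r in (0 : ℝ)..s, q r))) t -
        inner 𝕜 e (A u₀ + ∫ s in (0 : ℝ)..t, q s)) :
    ∀ t ∈ Ioc 0 T, v t = (u₀ : H) + ∫ s in (0 : ℝ)..t, hA.inv (q s) := by
  intro t₁ ht₁
  have hT : 0 < T := ht₁.1.trans_le ht₁.2
  have hRq := hq.clm hA.inv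
  set w : ℝ → H := fun t => A u₀ + ∫ s in (0 : ℝ)..t, q s with hw
  set y : ℝ → H := fun t => (u₀ : H) + ∫ s in (0 : ℝ)..t, hA.inv (q s) with hy
  have hRu : hA.inv (A u₀) = u₀ := by rw [← opApply_coe, hA.inv_opApply u₀.2]
  have hRw : ∀ t ∈ Icc 0 T, hA.inv (w t) = y t := fun t ht => by
    simp only [hw, hy]
    rw [map_add, hRu, hA.inv.intervalIntegral_comp_comm (hq.intervalIntegrable ha ht)]
  have hyd : ∀ t ∈ Ioc 0 T, HasDerivWithinAt y (hA.inv (q t)) (Ioc 0 T) t := fun t ht =>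
    hRq.hasDerivWithinAt_integral ha (c := (u₀ : H)) (fun _ _ => rfl) ht
  have hyc : ContinuousOn y (Icc 0 T) := by
    have h := intervalIntegral.continuousOn_primitive_interval'
      (hRq.intervalIntegrable ha ⟨hT.le, le_rfl⟩) left_mem_uIcc
    rw [uIcc_of_le hT.le] at h
    exact continuousOn_const.add h
  have hvc : ContinuousOn v (Icc 0 T) := by
    rw [funext hv]
    exact ContinuousOn.smul (by fun_prop) hu.continuousOn
  have hd := eq_zero_of_weak_solution (κ := κ) hA hα ha ha1 haα
    (fun j => ContinuousLinearMap.adjoint ((hB j).clm hA)) (d := fun t => v t - y t)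
    (hvc.sub hyc) (by simp [hv, hy, hu.initial]) ?_ t₁ ht₁
  · exact sub_eq_zero.1 hd
  intro l hl e he t ht
  have hte : t ∈ Icc 0 T := ⟨ht.1.le, ht.2⟩
  have h1 := hu.hasDerivWithinAt_inner hA hB hg hv he ht
  have h2 := hasDerivWithinAt_inner_right (𝕜 := 𝕜) (hyd t ht) e
  have hc : ∀ (j : Fin m) (x : ℝ → H), ContinuousOn x (Icc 0 T) → ContinuousOn (fun s => (l : 𝕜) *
      inner 𝕜 e (ContinuousLinearMap.adjoint ((hB j).clm hA) (x s))) (Icc 0 t) := fun j x hx => by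
    have h3 : Continuous fun z : H => (l : 𝕜) *
        inner 𝕜 e (ContinuousLinearMap.adjoint ((hB j).clm hA) z) := by fun_prop
    exact h3.comp_continuousOn (hx.mono (Icc_subset_Icc_right ht.2))
  have h4 : ∀ j, halfConv (abelKernel 𝕜 (α j)) (fun s => inner 𝕜 e ((hB j).clm hA (w s))) t =
      halfConv (abelKernel 𝕜 (α j)) (fun s => (l : 𝕜) *
        inner 𝕜 e (ContinuousLinearMap.adjoint ((hB j).clm hA) (y s))) t := fun j =>
    halfConv_congr_right ht.1.le fun s hs => by
      rw [(hB j).inner_clm hA he, hRw s ⟨hs.1.le, hs.2.trans ht.2⟩]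
  have h5 : ∀ j, halfConv (abelKernel 𝕜 (α j)) (fun s => (l : 𝕜) *
      inner 𝕜 e (ContinuousLinearMap.adjoint ((hB j).clm hA) (v s - y s))) t =
      halfConv (abelKernel 𝕜 (α j)) (fun s => (l : 𝕜) *
        inner 𝕜 e (ContinuousLinearMap.adjoint ((hB j).clm hA) (v s))) t -
      halfConv (abelKernel 𝕜 (α j)) (fun s => (l : 𝕜) *
        inner 𝕜 e (ContinuousLinearMap.adjoint ((hB j).clm hA) (y s))) t := fun j => by
    rw [halfConv, halfConv, halfConv, ← intervalIntegral.integral_sub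
      (intervalIntegrable_halfConv_integrand (hα j).1 ht.1.le (hc j v hvc))
      (intervalIntegrable_halfConv_integrand (hα j).1 ht.1.le (hc j y hyc))]
    simp only [map_sub, inner_sub_right, mul_sub]
  have h6 : (fun s => inner 𝕜 e (v s - y s)) = fun s => inner 𝕜 e (v s) - inner 𝕜 e (y s) :=
    funext fun s => inner_sub_right _ _ _
  have h7 : inner 𝕜 e (w t) = (l : 𝕜) * inner 𝕜 e (y t) := by
    rw [← hRw t hte, hA.inner_inv_right hl he, mul_inv_cancel_left₀
      (RCLike.ofReal_ne_zero.2 hl.ne')]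
  rw [h6]
  convert! h1.sub h2 using 1
  have h8 := hqeq l hl e he t ht
  change _ = _ + (κ : 𝕜) * inner 𝕜 e (hA.inv (w t)) -
    ∑ j, halfConv (abelKernel 𝕜 (α j)) (fun s => inner 𝕜 e ((hB j).clm hA (w s))) t -
    inner 𝕜 e (w t) at h8
  rw [h8, hRw t hte, h7, Finset.sum_congr rfl fun j _ => h4 j, Finset.sum_congr rfl fun j _ => h5 j,
    Finset.sum_sub_distrib, inner_sub_right]
  ring

omit [CompleteSpace H] [IsScalarTower ℝ 𝕜 H] in
/-- A bound `‖p'(t)‖ ≤ M t^{a-2}` makes `p` Lipschitz on `[t/2, t]`. -/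
theorem norm_sub_le_of_norm_deriv_le {a M T : ℝ} (ha1 : a ≤ 1) (hM : 0 ≤ M) {p p' : ℝ → H}
    (hp : ∀ t ∈ Ioc 0 T, HasDerivWithinAt p (p' t) (Ioc 0 T) t)
    (hp' : ∀ t ∈ Ioc 0 T, t * ‖p' t‖ ≤ M * t ^ (a - 1)) {t : ℝ} (ht : t ∈ Ioc 0 T) {s : ℝ}
    (hs : s ∈ Icc (t / 2) t) : ‖p s - p t‖ ≤ M * (t / 2) ^ (a - 2) * (t - s) := by
  have ht2 : 0 < t / 2 := half_pos ht.1
  have hsub : Icc (t / 2) t ⊆ Ioc 0 T := fun r hr => ⟨ht2.trans_le hr.1, hr.2.trans ht.2⟩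
  have h := (convex_Icc (t / 2) t).norm_image_sub_le_of_norm_hasDerivWithin_le (f := p) (f' := p')
    (C := M * (t / 2) ^ (a - 2)) (fun r hr => (hp r (hsub hr)).mono hsub) (fun r hr => ?_)
    (show t ∈ Icc (t / 2) t from ⟨by linarith, le_rfl⟩) hs
  · rwa [Real.norm_eq_abs, abs_sub_comm, abs_of_nonneg (sub_nonneg.2 hs.2)] at h
  · have hr0 : 0 < r := ht2.trans_le hr.1
    have h1 := hp' r (hsub hr)
    rw [show a - 1 = 1 + (a - 2) by ring, Real.rpow_add hr0, Real.rpow_one, mul_left_comm] at h1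
    refine (le_of_mul_le_mul_left h1 hr0).trans ?_
    exact mul_le_mul_of_nonneg_left
      (Real.rpow_le_rpow_of_nonpos ht2 hr.1 (by linarith)) hM

end Identification

theorem theorem2p5 {𝕜 H : Type*} [RCLike 𝕜] [NormedAddCommGroup H] [InnerProductSpace 𝕜 H]
    [NormedSpace ℝ H] [IsScalarTower ℝ 𝕜 H] [CompleteSpace H]
    (A : H →ₗ.[𝕜] H) (hA : IsPosDefWithCompactInverse A)
    {m : ℕ} [NeZero m] (B : Fin m → H →ₗ.[𝕜] H) (hB : ∀ j, IsDominatedBy (B j) A)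
    (α : Fin m → ℝ) (hα : ∀ j, α j ∈ Ioo (0 : ℝ) 1)
    (κ : ℝ) (hκ : 0 ≤ κ) (T : ℝ) (hT : 0 < T)
    (a : ℝ) (ha : a = Finset.univ.inf' Finset.univ_nonempty α) :
    ∃ K : ℝ, 0 < K ∧ ∀ (M : ℝ) (f u g v : ℝ → H) (u₀ : A.domain),
      IsTemperedSolution A B α κ T f u₀ u →
      (∀ t, g t = Real.exp (κ * t) • f t) → (∀ t, v t = Real.exp (κ * t) • u t) →
      DataBound A a T M g u₀ →
      ∃ v' v'' : ℝ → H,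
        (∀ t ∈ Ioc 0 T, HasDerivWithinAt v (v' t) (Ioc 0 T) t ∧
          HasDerivWithinAt v' (v'' t) (Ioc 0 T) t ∧ v' t ∈ A.domain) ∧
        (∀ t ∈ Ioc 0 T, ‖v'' t‖ + ‖opApply A (v' t)‖
          ≤ K * t ^ (a - 1) * (scaleNorm A 2 u₀ + M)) ∧
        ((u₀ : H) ≠ 0 → ∃ C : ℝ, 0 < C ∧ ∀ t ∈ Ioc 0 T,
          ‖v'' t‖ + ‖opApply A (v' t)‖ ≤ C * t ^ (a - 1) * scaleNorm A 2 u₀) := by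
  have haα : ∀ j, a ≤ α j := fun j => ha ▸ Finset.inf'_le _ (Finset.mem_univ j)
  obtain ⟨ha0, ha1⟩ : 0 < a ∧ a ≤ 1 := by
    obtain ⟨j, -, hj⟩ := Finset.exists_mem_eq_inf' (Finset.univ_nonempty (α := Fin m)) α
    rw [ha, hj]
    exact ⟨(hα j).1, (hα j).2.le⟩
  obtain ⟨K, hK0, hK⟩ := exists_regular_solution hA hα ha0 ha1 haα hT κ
    fun j => (hB j).clm hA
  refine ⟨2 * K + 1, by positivity, fun M f u g v u₀ hu hg hv hdata => ?_⟩
  obtain ⟨p, p', hp⟩ := hdata.bound_deriv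
  have hM : 0 ≤ M := (add_nonneg (norm_nonneg _) (norm_nonneg _)).trans
    (hdata.bound_zero T ⟨hT, le_rfl⟩)
  have hpw : WeaklySingular a M T p := ⟨fun t ht => (hp t ht).2.1.continuousWithinAt,
    fun t ht => by
      have h1 := (hp t ht).2.2
      have h2 := mul_nonneg ht.1.le (norm_nonneg (p' t))
      have h3 := norm_nonneg (deriv (fun s : ℝ => expSemigroup A s (A u₀ - g 0)) t)
      linarith⟩
  obtain ⟨q, z, hq, hz, hqz, hqeq⟩ := hK M g p (A u₀) hM hdata.continuousOn
    (fun t ht => (hp t ht).1) hpw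
    (fun t ht s hs => norm_sub_le_of_norm_deriv_le ha1 hM (fun t ht => (hp t ht).2.1)
      (fun t ht => by
        have h1 := (hp t ht).2.2
        have h2 := norm_nonneg (p t)
        have h3 := norm_nonneg (deriv (fun s : ℝ => expSemigroup A s (A u₀ - g 0)) t)
        linarith) ht hs)
    (fun t ht => by
      have h1 := (hp t ht).2.2
      have h2 := norm_nonneg (p t)
      have h3 := mul_nonneg ht.1.le (norm_nonneg (p' t))
      rw [hA.deriv_expSemigroup ht.1, norm_neg] at h1
      linarith)
  have hsol := hu.eq_regular_solution hA hB hα ha0 ha1 haα hg hv hq hqeq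
  have hbound : ∀ t ∈ Ioc 0 T, ‖z t‖ + ‖opApply A (hA.inv (q t))‖ ≤
      (2 * K + 1) * t ^ (a - 1) * (‖A u₀‖ + M) := by
    intro t ht
    rw [hA.opApply_inv]
    have h1 := hq.bound t ht
    have h2 := hz.bound t ht
    have h3 : 0 ≤ t ^ (a - 1) * (‖A u₀‖ + M) :=
      mul_nonneg (Real.rpow_nonneg ht.1.le _) (add_nonneg (norm_nonneg _) hM)
    linarith
  refine ⟨fun t => hA.inv (q t), z, fun t ht => ⟨?_, hqz t ht, hA.inv_mem _⟩, hbound, fun h0 => ?_⟩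
  · exact (hq.clm hA.inv).hasDerivWithinAt_integral ha0 hsol ht
  · have hA0 : 0 < ‖A u₀‖ := by
      refine norm_pos_iff.2 fun h => h0 ?_
      rw [← hA.inv_opApply u₀.2, opApply_coe, h, map_zero]
    refine ⟨(2 * K + 1) * (1 + M / ‖A u₀‖), by positivity, fun t ht => ?_⟩
    refine (hbound t ht).trans (le_of_eq ?_)
    change _ = _ * ‖A u₀‖
    field_simp
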